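/- Theorem (Existence and consistency of the GEE estimator with diverging dimension). Fix a cluster size $m$ and let $(p_n)$ be a sequence of dimensions. For each $n$ let $X_{ij}=X_{n,ij}\in\mathbb R^{p_n}$ ($1\le i\le n$, $1\le j\le m$) be fixed (nonrandom) covariates, $X_i$ the $m\times p_n$ matrix with rows $X_{ij}^T$, and $\beta_{n0}\in\mathbb R^{p_n}$. For $\beta\in\mathbb R^{p_n}$ put $$\pi_{ij}(\beta)=\frac{\exp(X_{ij}^T\beta)}{1+\exp(X_{ij}^T\beta)},\qquad A_i(\beta)=\operatorname{diag}\bigl(\pi_{ij}(\beta)(1-\pi_{ij}(\beta))\bigr)_{j=1}^m,\qquad \pi_i(\beta)=(\pi_{i1}(\beta),\dots,\pi_{im}(\beta))^T.$$ On a probability space (which may depend on $n$) let $Y_{ij}$ be $\{0,1\}$-valued random variables with $E(Y_{ij})=\pi_{ij}(\beta_{n0})$ such that the clusters $Y_i=(Y_{i1},\dots,Y_{im})^T$, $i=1,\dots,n$, are independent (observations in the same cluster may be dependent), and let $\widehat R=\widehat R_n$ be a random $m\times m$ matrix (the estimated working correlation matrix). The generalized estimating equation is $$S_n(\beta)=\sum_{i=1}^n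 X_i^TA_i^{1/2}(\beta)\,\widehat R^{-1}A_i^{-1/2}(\beta)\,\bigl(Y_i-\pi_i(\beta)\bigr)=0 .$$ Write $\|\cdot\|$ for the Euclidean norm of a vector and the Frobenius norm of a matrix, and $Z_n=O_p(a_n)$ if for every $\varepsilon>0$ there is $K$ with $P(|Z_n|>Ka_n)\le\varepsilon$ for all large $n$. Assume that, with constants not depending on $n$ and bounds holding for all large $n$: (A1) $\sup_{i,j}\|X_{ij}\|=O(\sqrt{p_n})$; (A2) $\beta_{n0}$ lies in the interior of a compact set $\mathcal B_n\subseteq\mathbb R^{p_n}$, and there are constants $b_1,b_2$ with $0<b_1\le\pi_{ij}(\beta_{n0})\le b_2<1$ for all $i,j$; (A3) there are constants $b_3,b_4>0$ with $b_3\le\lambda_{\min}\bigl(n^{-1}\sum_{i=1}^nX_i^TX_i\bigr)\le\lambda_{\max}\bigl(n^{-1}\sum_{i=1}^nX_i^TX_i\bigr)\le b_4$; (A4) all clusters $Y_i$ have the same correlation matrix $R_0$, whose eigenvalues are bounded away from $0$ and $+\infty$; and $\|\widehat R^{-1}-\overline R^{-1}\|=O_p(\sqrt{p_n/n})$ for some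 nonrandom positive definite matrix $\overline R$ with eigenvalues bounded away from $0$ and $+\infty$ ($R_0$ and $\overline R$ may depend on $n$ and need not be equal; $\widehat R^{-1}$ is read as $0$ where $\widehat R$ is singular). If $p_n^2/n\to0$, then there are random vectors $\widehat\beta_n$ in $\mathbb R^{p_n}$ such that, with probability tending to one, $\widehat R$ is invertible and $S_n(\widehat\beta_n)=0$, and $$\|\widehat\beta_n-\beta_{n0}\|=O_p\bigl(\sqrt{p_n/n}\bigr).$$ -/

import Mathlib

open Filter Topology MeasureTheory ProbabilityTheory
open scoped Matrix

noncomputable section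

namespace GEE

/-- The inverse logit of the linear predictor: `π(x, β) = exp(xᵀβ) / (1 + exp(xᵀβ))`. -/
def prob {p : ℕ} (x β : EuclideanSpace ℝ (Fin p)) : ℝ :=
  Real.exp (inner ℝ x β) / (1 + Real.exp (inner ℝ x β))

/-- The marginal variance `A(x, β) = π(x, β) (1 - π(x, β))`. -/
def margVar {p : ℕ} (x β : EuclideanSpace ℝ (Fin p)) : ℝ :=
  prob x β * (1 - prob x β)

/-- The `m × p` covariate matrix of one cluster; its `j`-th row is the covariate vector of the
`j`-th observation. -/
def designMatrix {m p : ℕ} (x : Fin m → EuclideanSpace ℝ (Fin p)) :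
    Matrix (Fin m) (Fin p) ℝ :=
  Matrix.of fun j k => x j k

/-- `A(β)^{1/2}` for one cluster. -/
def sqrtVar {m p : ℕ} (x : Fin m → EuclideanSpace ℝ (Fin p)) (β : EuclideanSpace ℝ (Fin p)) :
    Matrix (Fin m) (Fin m) ℝ :=
  Matrix.diagonal fun j => √(margVar (x j) β)

/-- `A(β)^{-1/2}` for one cluster (the diagonal of `A(β)` is always positive). -/
def invSqrtVar {m p : ℕ} (x : Fin m → EuclideanSpace ℝ (Fin p)) (β : EuclideanSpace ℝ (Fin p)) :
    Matrix (Fin m) (Fin m) ℝ :=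
  Matrix.diagonal fun j => (√(margVar (x j) β))⁻¹

/-- The estimating function
`S(β) = ∑ᵢ Xᵢᵀ Aᵢ(β)^{1/2} R⁻¹ Aᵢ(β)^{-1/2} (yᵢ - πᵢ(β))`
for `n` clusters of size `m`, with covariates `x`, responses `y` and working correlation
matrix `R`. -/
def score {n m p : ℕ} (x : Fin n → Fin m → EuclideanSpace ℝ (Fin p)) (y : Fin n → Fin m → ℝ)
    (R : Matrix (Fin m) (Fin m) ℝ) (β : EuclideanSpace ℝ (Fin p)) : Fin p → ℝ :=
  ∑ i, ((designMatrix (x i))ᵀ * sqrtVar (x i) β * R⁻¹ * invSqrtVar (x i) β) *ᵥ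
    (fun j => y i j - prob (x i j) β)

/-- The normalized Gram matrix `n⁻¹ ∑ᵢ Xᵢᵀ Xᵢ`. -/
def gram {n m p : ℕ} (x : Fin n → Fin m → EuclideanSpace ℝ (Fin p)) :
    Matrix (Fin p) (Fin p) ℝ :=
  (n : ℝ)⁻¹ • ∑ i, (designMatrix (x i))ᵀ * designMatrix (x i)

/-- The Frobenius norm `(Tr (B Bᵀ))^{1/2}`. -/
def frobNorm {m : ℕ} (B : Matrix (Fin m) (Fin m) ℝ) : ℝ :=
  √((B * Bᵀ).trace)

/-- All (real) eigenvalues of `B` lie in `[a, b]`. Used for symmetric matrices only, where it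
says `a ≤ λ_min(B)` and `λ_max(B) ≤ b`. -/
def EigenvaluesIn {k : ℕ} (B : Matrix (Fin k) (Fin k) ℝ) (a b : ℝ) : Prop :=
  ∀ μ : ℝ, Module.End.HasEigenvalue (Matrix.toLin' B) μ → a ≤ μ ∧ μ ≤ b

/-- The correlation coefficient of two real random variables. -/
def corr {Ω : Type*} [MeasurableSpace Ω] (P : Measure Ω) (U V : Ω → ℝ) : ℝ :=
  cov[U, V; P] / (√(variance U P) * √(variance V P))

/-- `Z n = O_p(a n)`: for each `ε > 0` there is `K` with `P(|Z n| > K a n) ≤ ε` for all large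
`n`. Each `Z n` may live on a probability space of its own. -/
def IsBigOP {Ω : ℕ → Type*} [∀ n, MeasurableSpace (Ω n)] (P : ∀ n, Measure (Ω n))
    (Z : ∀ n, Ω n → ℝ) (a : ℕ → ℝ) : Prop :=
  ∀ ε : ℝ, 0 < ε → ∃ K : ℝ, ∀ᶠ n in atTop,
    P n {ω | K * a n < |Z n ω|} ≤ ENNReal.ofReal ε

/-- The marginal model for clustered binary data with logit link and fixed covariates `x`: the
`Y i j` are `{0,1}`-valued random variables, the clusters `(Y i 1, …, Y i m)`, `i = 1, …, n`,
are independent, and `E (Y i j) = π(x i j, β₀)`. (Then `Var (Y i j) = π (1 - π)` as `Y i j` is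
binary.) Nothing is assumed about the dependence inside a cluster. -/
structure IsClusteredBinary {n m p : ℕ} {Ω : Type*} [MeasurableSpace Ω] (P : Measure Ω)
    (x : Fin n → Fin m → EuclideanSpace ℝ (Fin p)) (Y : Fin n → Fin m → Ω → ℝ)
    (β₀ : EuclideanSpace ℝ (Fin p)) : Prop where
  measurable : ∀ i j, Measurable (Y i j)
  binary : ∀ i j, ∀ᵐ ω ∂P, Y i j ω = 0 ∨ Y i j ω = 1
  indep : iIndepFun (fun i ω j => Y i j ω : Fin n → Ω → Fin m → ℝ) P
  mean : ∀ i j, ∫ ω, Y i j ω ∂P = prob (x i j) β₀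

/-- The covariate bound `sup_{i,j} ‖X_{ij}‖ = O(√p_n)`. -/
def CovariateBound {m : ℕ} {p : ℕ → ℕ} (x : ∀ n, Fin n → Fin m → EuclideanSpace ℝ (Fin (p n))) : Prop :=
  ∃ C : ℝ, ∀ᶠ n in atTop, ∀ i j, ‖x n i j‖ ≤ C * √(p n)

/-- The parameter set `B n` is compact, the true parameter is interior to it, and
the true success probabilities are bounded away from `0` and `1`, uniformly in `n, i, j`. -/
def ParameterCondition {m : ℕ} {p : ℕ → ℕ} (x : ∀ n, Fin n → Fin m → EuclideanSpace ℝ (Fin (p n)))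
    (B : ∀ n, Set (EuclideanSpace ℝ (Fin (p n)))) (β₀ : ∀ n, EuclideanSpace ℝ (Fin (p n))) :
    Prop :=
  (∀ n, IsCompact (B n) ∧ β₀ n ∈ interior (B n)) ∧
  ∃ b₁ b₂ : ℝ, 0 < b₁ ∧ b₂ < 1 ∧
    ∀ᶠ n in atTop, ∀ i j, b₁ ≤ prob (x n i j) (β₀ n) ∧ prob (x n i j) (β₀ n) ≤ b₂

/-- The design condition `b₃ ≤ λ_min(n⁻¹ ∑ᵢ XᵢᵀXᵢ) ≤ λ_max(n⁻¹ ∑ᵢ XᵢᵀXᵢ) ≤ b₄`. -/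
def GramCondition {m : ℕ} {p : ℕ → ℕ} (x : ∀ n, Fin n → Fin m → EuclideanSpace ℝ (Fin (p n))) : Prop :=
  ∃ b₃ b₄ : ℝ, 0 < b₃ ∧ 0 < b₄ ∧ ∀ᶠ n in atTop, EigenvaluesIn (gram (x n)) b₃ b₄

/-- All clusters have the common true correlation matrix `R₀ n`, whose eigenvalues
are bounded away from `0` and `∞`; and the estimated working correlation matrix `Rhat n` satisfies
`‖Rhat⁻¹ - Rbar⁻¹‖ = O_p(√(p_n/n))` in Frobenius norm, where `Rbar n` is a nonrandom positive
definite matrix with eigenvalues bounded away from `0` and `∞`. Neither `Rhat` nor `Rbar` need be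
related to `R₀`. -/
def CorrelationCondition {m : ℕ} (p : ℕ → ℕ) {Ω : ℕ → Type*} [∀ n, MeasurableSpace (Ω n)]
    (P : ∀ n, Measure (Ω n)) (Y : ∀ n, Fin n → Fin m → Ω n → ℝ)
    (R₀ Rbar : ℕ → Matrix (Fin m) (Fin m) ℝ) (Rhat : ∀ n, Ω n → Matrix (Fin m) (Fin m) ℝ) :
    Prop :=
  (∀ n i j k, corr (P n) (Y n i j) (Y n i k) = R₀ n j k) ∧
  (∃ c₁ c₂ : ℝ, 0 < c₁ ∧ ∀ᶠ n in atTop, EigenvaluesIn (R₀ n) c₁ c₂) ∧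
  (∀ n, (Rbar n).PosDef) ∧
  (∃ c₁ c₂ : ℝ, 0 < c₁ ∧ ∀ᶠ n in atTop, EigenvaluesIn (Rbar n) c₁ c₂) ∧
  IsBigOP P (fun n ω => frobNorm ((Rhat n ω)⁻¹ - (Rbar n)⁻¹)) (fun n => √((p n : ℝ) / n))

end GEE

end

/-!
A zero of the estimating function `S` near `β₀` is found as the limit of a contraction, which is
also what makes the estimator measurable: no fixed point theorem of Brouwer type is needed.

Write `w(s) = 1 / (e^{s/2} + e^{-s/2})`, the standard deviation of a Bernoulli variable with linear
predictor `s`, and `r_y(t) = y e^{-t/2} - (1 - y) e^{t/2}`, its Pearson residual. Then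
`S(β) = ∑ᵢⱼₖ w(Xᵢⱼᵀβ) (R̂⁻¹)ⱼₖ r_{Yᵢₖ}(Xᵢₖᵀβ) Xᵢⱼ` (`score_eq`), a sum of products of smooth
functions of scalars. On a ball of radius `M √(p/n)` around `β₀` all linear predictors stay within
`O(p/√n) = o(1)` of their value at `β₀`, so the summands may be linearized at `β₀` uniformly
(`SummandBound`). The linear part of `-S/n` is

* a leading term `n⁻¹ ∑ᵢ Xᵢᵀ Aᵢ^{1/2} R̂⁻¹ Aᵢ^{1/2} Xᵢ`, bounded below since `R̂⁻¹` is close to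
  `R̄⁻¹` and the Gram matrix is bounded below;
* finitely many matrices of the form `n⁻¹ ∑ᵢ αᵢ (Yᵢₖ - πᵢₖ) Xᵢⱼ Xᵢₗᵀ` with bounded nonrandom `αᵢ`,
  whose Frobenius norm is `O_p(p/√n) = o_p(1)` by independence of the clusters and Markov's
  inequality (`IsClusteredBinary.measure_noise_le`).

Hence, with large probability, `-S/n` is strongly monotone and Lipschitz on the ball, with constants
that do not depend on `n`, the probability or the radius (`le_inner_scoreVec_sub`,
`norm_scoreVec_sub_le`). For a suitable fixed `τ`, the map `β ↦ β + τ S(β)/n` is then a contraction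
there, and `‖S(β₀)‖/n = O_p(√(p/n))` makes it preserve the ball for large `M`. Its iterates from
`β₀` converge to a zero of `S` in the ball (`exists_zero_of_stronglyMonotone`,
`exists_zero_scoreVec`). The estimator is the limit of these iterates; it does not depend on the
ball, so the same random vector serves every level of probability (`exists_tail_bound`).
-/

namespace GEE

/-! ### The logit link and the Pearson residual -/

/-- The standard deviation `√(π (1 - π))` of a Bernoulli variable whose success probability `π` has
logit `s`, in closed form; see `sqrt_logistic_var`. -/
noncomputable def stdDev (s : ℝ) : ℝ := (Real.exp (s / 2) + Real.exp (-(s / 2)))⁻¹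

/-- The Pearson residual `(y - π) / √(π (1 - π))` of a response `y` at linear predictor `t`, in
closed form; see `inv_stdDev_mul_sub_logistic`. -/
noncomputable def pearson (y t : ℝ) : ℝ := y * Real.exp (-(t / 2)) - (1 - y) * Real.exp (t / 2)

/-- The inverse logit, so that `prob x β` is `logistic ⟪x, β⟫` by definition. -/
noncomputable def logistic (t : ℝ) : ℝ := Real.exp t / (1 + Real.exp t)

theorem stdDev_pos (s : ℝ) : 0 < stdDev s := by unfold stdDev; positivity

theorem logistic_eq (t : ℝ) : logistic t = stdDev t * Real.exp (t / 2) := by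
  have h : Real.exp t = Real.exp (t / 2) * Real.exp (t / 2) := by
    rw [← Real.exp_add]; ring_nf
  have h' : Real.exp (-(t / 2)) * Real.exp (t / 2) = 1 := by
    rw [← Real.exp_add]; simp
  unfold logistic stdDev
  have := Real.exp_pos (t / 2)
  have := Real.exp_pos (-(t / 2))
  rw [inv_mul_eq_div, div_eq_div_iff (by positivity) (by positivity), h]
  linear_combination Real.exp (t / 2) * h'

theorem one_sub_logistic_eq (t : ℝ) : 1 - logistic t = stdDev t * Real.exp (-(t / 2)) := by
  rw [logistic_eq]
  unfold stdDev
  have := Real.exp_pos (t / 2)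
  have := Real.exp_pos (-(t / 2))
  field_simp
  ring

theorem sqrt_logistic_var (t : ℝ) : √(logistic t * (1 - logistic t)) = stdDev t := by
  have h' : Real.exp (t / 2) * Real.exp (-(t / 2)) = 1 := by
    rw [← Real.exp_add]; simp
  rw [show logistic t * (1 - logistic t) = stdDev t ^ 2 by
    rw [logistic_eq t, ← logistic_eq, one_sub_logistic_eq, logistic_eq]
    linear_combination stdDev t ^ 2 * h']
  exact Real.sqrt_sq (stdDev_pos t).le

theorem inv_stdDev_mul_sub_logistic (y t : ℝ) :
    (stdDev t)⁻¹ * (y - logistic t) = pearson y t := by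
  have h := logistic_eq t
  have h2 := one_sub_logistic_eq t
  have := (stdDev_pos t).ne'
  rw [show y - logistic t = y * (1 - logistic t) - (1 - y) * logistic t by ring, h2, h]
  unfold pearson
  field_simp

/-- The derivative of `stdDev`. -/
noncomputable def stdDevDeriv (s : ℝ) : ℝ :=
  -((Real.exp (s / 2) - Real.exp (-(s / 2))) / 2) * stdDev s ^ 2

/-- The derivative of `pearson y`. -/
noncomputable def pearsonDeriv (y t : ℝ) : ℝ :=
  -((y * Real.exp (-(t / 2)) + (1 - y) * Real.exp (t / 2)) / 2)

theorem hasDerivAt_stdDev (s : ℝ) : HasDerivAt stdDev (stdDevDeriv s) s := by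
  have h1 : HasDerivAt (fun s : ℝ => s / 2) (1 / 2) s := (hasDerivAt_id s).div_const 2
  have h1' : HasDerivAt (fun s : ℝ => -(s / 2)) (-(1 / 2)) s := h1.neg
  have h2 := (h1.exp.add h1'.exp).inv (c := fun s => Real.exp (s / 2) + Real.exp (-(s / 2)))
    (by positivity)
  refine h2.congr_deriv ?_
  unfold stdDevDeriv stdDev
  field_simp
  ring

theorem hasDerivAt_pearson (y t : ℝ) : HasDerivAt (pearson y) (pearsonDeriv y t) t := by
  have h1 : HasDerivAt (fun s : ℝ => s / 2) (1 / 2) t := (hasDerivAt_id t).div_const 2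
  have h1' : HasDerivAt (fun s : ℝ => -(s / 2)) (-(1 / 2)) t := h1.neg
  have h2 := (h1'.exp.const_mul y).sub (h1.exp.const_mul (1 - y))
  refine h2.congr_deriv ?_
  unfold pearsonDeriv
  ring

theorem contDiff_stdDev : ContDiff ℝ 2 stdDev := by
  unfold stdDev
  exact ContDiff.inv (by fun_prop) (fun s => by positivity)

theorem contDiff_pearson (y : ℝ) : ContDiff ℝ 2 (pearson y) := by
  unfold pearson
  fun_prop

/-- The derivative of the Pearson residual is `-stdDev t` up to a multiple of `y - logistic t`,
which has mean zero at the true parameter. -/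
theorem pearsonDeriv_add_stdDev (y t : ℝ) :
    pearsonDeriv y t + stdDev t = Real.sinh (t / 2) * (y - logistic t) := by
  have h : Real.exp (t / 2) * Real.exp (-(t / 2)) = 1 := by
    rw [← Real.exp_add]; simp
  have h' : stdDev t * (Real.exp (t / 2) + Real.exp (-(t / 2))) = 1 := by
    unfold stdDev; exact inv_mul_cancel₀ (by positivity)
  unfold pearsonDeriv
  rw [logistic_eq, Real.sinh_eq]
  linear_combination (Real.exp (t / 2) / 2) * h' - stdDev t * h

/-- On `[-T, T]`, `f` and `f'` are bounded by `L`, `f` is `L`-Lipschitz, and linearizing increments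
of `f` between points within `ρ` of `z` by the slope `f' z` has relative error at most `L ρ`. -/
structure TaylorBound (f f' : ℝ → ℝ) (T L : ℝ) : Prop where
  abs_le : ∀ s ∈ Set.Icc (-T) T, |f s| ≤ L
  abs_deriv_le : ∀ s ∈ Set.Icc (-T) T, |f' s| ≤ L
  lipschitz : ∀ s ∈ Set.Icc (-T) T, ∀ s' ∈ Set.Icc (-T) T, |f s - f s'| ≤ L * |s - s'|
  taylor : ∀ s ∈ Set.Icc (-T) T, ∀ s' ∈ Set.Icc (-T) T, ∀ z ∈ Set.Icc (-T) T, ∀ ρ,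
    |s - z| ≤ ρ → |s' - z| ≤ ρ → |f s - f s' - f' z * (s - s')| ≤ L * ρ * |s - s'|

theorem TaylorBound.mono {f f' : ℝ → ℝ} {T L M : ℝ} (h : TaylorBound f f' T L) (hLM : L ≤ M) :
    TaylorBound f f' T M where
  abs_le s hs := (h.abs_le s hs).trans hLM
  abs_deriv_le s hs := (h.abs_deriv_le s hs).trans hLM
  lipschitz s hs s' hs' := (h.lipschitz s hs s' hs').trans (by gcongr)
  taylor s hs s' hs' z hz ρ h₁ h₂ := by
    have : 0 ≤ ρ := (abs_nonneg _).trans h₁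
    exact (h.taylor s hs s' hs' z hz ρ h₁ h₂).trans (by gcongr)

theorem exists_taylorBound {f f' : ℝ → ℝ} (hf : ContDiff ℝ 2 f)
    (hf' : ∀ s, HasDerivAt f (f' s) s) (T : ℝ) : ∃ L, 0 ≤ L ∧ TaylorBound f f' T L := by
  have hd : deriv f = f' := funext fun s => (hf' s).deriv
  have hf1 : ContDiff ℝ 1 f' := by
    rw [← hd]
    exact ((contDiff_succ_iff_deriv (n := 1)).1 (by rw [one_add_one_eq_two]; exact hf)).2.2
  have hcomp : IsCompact (Set.Icc (-T) T) := isCompact_Icc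
  obtain ⟨L₀, h0⟩ := hcomp.exists_bound_of_continuousOn hf.continuous.continuousOn
  obtain ⟨L₁, h1⟩ := hcomp.exists_bound_of_continuousOn hf1.continuous.continuousOn
  obtain ⟨L₂, h2⟩ := hcomp.exists_bound_of_continuousOn
    (hf1.continuous_deriv le_rfl).continuousOn
  have hL : ∃ L, 0 ≤ L ∧ L₀ ≤ L ∧ L₁ ≤ L ∧ L₂ ≤ L :=
    ⟨max 0 (max L₀ (max L₁ L₂)), by simp⟩
  obtain ⟨L, hL, hL0, hL1, hL2⟩ := hL
  refine ⟨L, hL, fun s hs => (h0 s hs).trans hL0, fun s hs => (h1 s hs).trans hL1, ?_, ?_⟩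
  · intro s hs s' hs'
    exact (convex_Icc _ _).norm_image_sub_le_of_norm_hasDerivWithin_le
      (fun u _ => (hf' u).hasDerivWithinAt) (fun u hu => (h1 u hu).trans hL1) hs' hs
  · intro s hs s' hs' z hz ρ hsz hsz'
    have key : ∀ u ∈ Set.Icc (-T) T ∩ Metric.closedBall z ρ, ‖f' u - f' z‖ ≤ L * ρ := by
      rintro u ⟨hu, huz⟩
      have := (convex_Icc (-T) T).norm_image_sub_le_of_norm_hasDerivWithin_le
        (fun u _ => ((hf1.differentiable one_ne_zero) u).hasDerivAt.hasDerivWithinAt)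
        (fun u hu => (h2 u hu).trans hL2) hz hu
      exact this.trans (mul_le_mul_of_nonneg_left huz hL)
    have := ((convex_Icc (-T) T).inter
      (convex_closedBall z ρ)).norm_image_sub_le_of_norm_hasDerivWithin_le
      (f := fun u => f u - f' z * u)
      (fun u _ => ((hf' u).sub ((hasDerivAt_id u).const_mul (f' z))).hasDerivWithinAt)
      (fun u hu => by simpa using key u hu) (x := s') (y := s) ⟨hs', hsz'⟩ ⟨hs, hsz⟩
    rw [Real.norm_eq_abs, Real.norm_eq_abs] at this
    convert this using 2
    ring

/-- Bounds on `[-T, T]` for `(s, t) ↦ stdDev s * pearson y t`, the summand of the estimating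
function, for both values of the response `y`: it is `L`-Lipschitz, and linearizing its increments
near `(s₀, t₀)` by its gradient there has relative error at most `L ρ` within distance `ρ`. -/
structure SummandBound (T L : ℝ) : Prop where
  lipschitz : ∀ y, (y = 0 ∨ y = 1) → ∀ s ∈ Set.Icc (-T) T, ∀ s' ∈ Set.Icc (-T) T,
    ∀ t ∈ Set.Icc (-T) T, ∀ t' ∈ Set.Icc (-T) T,
    |stdDev s * pearson y t - stdDev s' * pearson y t'| ≤ L * (|s - s'| + |t - t'|)
  taylor : ∀ y, (y = 0 ∨ y = 1) → ∀ s ∈ Set.Icc (-T) T, ∀ s' ∈ Set.Icc (-T) T,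
    ∀ t ∈ Set.Icc (-T) T, ∀ t' ∈ Set.Icc (-T) T, ∀ s₀ ∈ Set.Icc (-T) T, ∀ t₀ ∈ Set.Icc (-T) T,
    ∀ ρ, |s - s₀| ≤ ρ → |s' - s₀| ≤ ρ → |t - t₀| ≤ ρ → |t' - t₀| ≤ ρ →
      |stdDev s * pearson y t - stdDev s' * pearson y t' -
        (stdDevDeriv s₀ * pearson y t₀ * (s - s') +
          stdDev s₀ * pearsonDeriv y t₀ * (t - t'))| ≤ L * ρ * (|s - s'| + |t - t'|)

theorem exists_summandBound (T : ℝ) : ∃ L, 0 ≤ L ∧ SummandBound T L := by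
  obtain ⟨A, hA, ha⟩ := exists_taylorBound contDiff_stdDev hasDerivAt_stdDev T
  obtain ⟨M, hM, hm⟩ : ∃ M, 0 ≤ M ∧
      ∀ y, (y = 0 ∨ y = 1) → TaylorBound (pearson y) (pearsonDeriv y) T M := by
    obtain ⟨M₀, hM₀, h0⟩ := exists_taylorBound (contDiff_pearson 0) (hasDerivAt_pearson 0) T
    obtain ⟨M₁, hM₁, h1⟩ := exists_taylorBound (contDiff_pearson 1) (hasDerivAt_pearson 1) T
    refine ⟨max M₀ M₁, le_max_of_le_left hM₀, ?_⟩
    rintro y (rfl | rfl)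
    · exact h0.mono (le_max_left _ _)
    · exact h1.mono (le_max_right _ _)
  refine ⟨2 * A * M, by positivity, ?_, ?_⟩
  · intro y hy s hs s' hs' t ht t' ht'
    rw [show stdDev s * pearson y t - stdDev s' * pearson y t' =
      (stdDev s - stdDev s') * pearson y t + stdDev s' * (pearson y t - pearson y t') by ring]
    refine (abs_add_le _ _).trans ?_
    rw [abs_mul, abs_mul]
    have e1 := mul_le_mul (ha.lipschitz s hs s' hs') ((hm y hy).abs_le t ht)
      (abs_nonneg _) (by positivity)
    have e2 := mul_le_mul (ha.abs_le s' hs') ((hm y hy).lipschitz t ht t' ht')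
      (abs_nonneg _) (by positivity)
    have e3 : 0 ≤ A * M * (|s - s'| + |t - t'|) := by positivity
    linarith
  · intro y hy s hs s' hs' t ht t' ht' s₀ hs₀ t₀ ht₀ ρ h1 h2 h3 h4
    have hρ : 0 ≤ ρ := (abs_nonneg _).trans h1
    have cs' := ha.abs_deriv_le s₀ hs₀
    have rt' := (hm y hy).abs_deriv_le t₀ ht₀
    rw [show stdDev s * pearson y t - stdDev s' * pearson y t' -
          (stdDevDeriv s₀ * pearson y t₀ * (s - s') +
            stdDev s₀ * pearsonDeriv y t₀ * (t - t')) =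
      (stdDev s - stdDev s' - stdDevDeriv s₀ * (s - s')) * pearson y t +
      stdDevDeriv s₀ * (s - s') * (pearson y t - pearson y t₀) +
      stdDev s' * (pearson y t - pearson y t' - pearsonDeriv y t₀ * (t - t')) +
      (stdDev s' - stdDev s₀) * (pearsonDeriv y t₀ * (t - t')) by ring]
    have e1 : |(stdDev s - stdDev s' - stdDevDeriv s₀ * (s - s')) * pearson y t| ≤
        A * ρ * |s - s'| * M := by
      rw [abs_mul]
      exact mul_le_mul (ha.taylor s hs s' hs' s₀ hs₀ ρ h1 h2) ((hm y hy).abs_le t ht)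
        (abs_nonneg _) (by positivity)
    have e2 : |stdDevDeriv s₀ * (s - s') * (pearson y t - pearson y t₀)| ≤
        A * |s - s'| * (M * ρ) := by
      rw [abs_mul, abs_mul]
      have := ((hm y hy).lipschitz t ht t₀ ht₀).trans (mul_le_mul_of_nonneg_left h3 hM)
      gcongr
    have e3 : |stdDev s' * (pearson y t - pearson y t' - pearsonDeriv y t₀ * (t - t'))| ≤
        A * (M * ρ * |t - t'|) := by
      rw [abs_mul]
      exact mul_le_mul (ha.abs_le s' hs')
        ((hm y hy).taylor t ht t' ht' t₀ ht₀ ρ h3 h4) (abs_nonneg _) (by positivity)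
    have e4 : |(stdDev s' - stdDev s₀) * (pearsonDeriv y t₀ * (t - t'))| ≤
        A * ρ * (M * |t - t'|) := by
      rw [abs_mul, abs_mul]
      have := (ha.lipschitz s' hs' s₀ hs₀).trans (mul_le_mul_of_nonneg_left h2 hA)
      gcongr
    have := abs_add_three ((stdDev s - stdDev s' - stdDevDeriv s₀ * (s - s')) * pearson y t)
      (stdDevDeriv s₀ * (s - s') * (pearson y t - pearson y t₀))
      (stdDev s' * (pearson y t - pearson y t' - pearsonDeriv y t₀ * (t - t')))
    refine (abs_add_le _ _).trans ?_
    linarith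

theorem abs_le_of_logistic_mem {b₁ b₂ t : ℝ} (hb₁ : 0 < b₁) (hb₂ : b₂ < 1)
    (h₁ : b₁ ≤ logistic t) (h₂ : logistic t ≤ b₂) :
    |t| ≤ max (-Real.log b₁) (-Real.log (1 - b₂)) := by
  have hpos := Real.exp_pos t
  unfold logistic at h₁ h₂
  rw [le_div_iff₀ (by positivity)] at h₁
  rw [div_le_iff₀ (by positivity)] at h₂
  have e1 : Real.log b₁ ≤ t := by
    rw [Real.log_le_iff_le_exp hb₁]; nlinarith
  have e2 : Real.log (1 - b₂) ≤ -t := by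
    rw [Real.log_le_iff_le_exp (by linarith), Real.exp_neg, le_inv_comm₀ (by linarith) hpos,
      ← one_div, le_div_iff₀ (by linarith)]
    nlinarith
  rw [abs_le]
  constructor
  · have := le_max_left (-Real.log b₁) (-Real.log (1 - b₂)); linarith
  · have := le_max_right (-Real.log b₁) (-Real.log (1 - b₂)); linarith

/-- A bound `A` on `[-T, T]` for the functions of the linear predictors that multiply the centred
responses in the linearized estimating function. -/
structure CoefficientBound (T A : ℝ) : Prop where
  stdDev_le : ∀ s, |s| ≤ T → |stdDev s| ≤ A
  inv_stdDev_le : ∀ s, |s| ≤ T → |(stdDev s)⁻¹| ≤ A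
  stdDevDeriv_le : ∀ s, |s| ≤ T → |stdDevDeriv s| ≤ A
  sinh_le : ∀ s, |s| ≤ T → |Real.sinh (s / 2)| ≤ A

theorem exists_coefficientBound (T : ℝ) : ∃ A, 0 < A ∧ CoefficientBound T A := by
  have key : ∀ f : ℝ → ℝ, Continuous f → ∃ A, ∀ s, |s| ≤ T → |f s| ≤ A := by
    intro f hf
    obtain ⟨A, hA⟩ := (isCompact_Icc (a := -T) (b := T)).exists_bound_of_continuousOn
      hf.continuousOn
    exact ⟨A, fun s hs => hA s (abs_le.1 hs)⟩
  have hc := contDiff_stdDev.continuous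
  obtain ⟨A₁, h₁⟩ := key _ hc
  obtain ⟨A₂, h₂⟩ := key _ (hc.inv₀ fun s => (stdDev_pos s).ne')
  obtain ⟨A₃, h₃⟩ := key stdDevDeriv (by unfold stdDevDeriv; fun_prop)
  obtain ⟨A₄, h₄⟩ := key (fun s => Real.sinh (s / 2)) (by fun_prop)
  obtain ⟨A, h0, hA₁, hA₂, hA₃, hA₄⟩ : ∃ A, 1 ≤ A ∧ A₁ ≤ A ∧ A₂ ≤ A ∧ A₃ ≤ A ∧ A₄ ≤ A :=
    ⟨max 1 (max A₁ (max A₂ (max A₃ A₄))), by simp⟩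
  exact ⟨A, by linarith, fun s hs => (h₁ s hs).trans hA₁, fun s hs => (h₂ s hs).trans hA₂,
    fun s hs => (h₃ s hs).trans hA₃, fun s hs => (h₄ s hs).trans hA₄⟩

/-! ### Quadratic forms of matrices with eigenvalue bounds -/

/-- Eigenvalue bounds of a symmetric matrix as bounds of its quadratic form. -/
theorem EigenvaluesIn.quadForm_bounds {k : ℕ} {B : Matrix (Fin k) (Fin k) ℝ} {a b : ℝ}
    (h : EigenvaluesIn B a b) (hB : B.IsHermitian) (z : Fin k → ℝ) :
    a * (z ⬝ᵥ z) ≤ z ⬝ᵥ (B *ᵥ z) ∧ z ⬝ᵥ (B *ᵥ z) ≤ b * (z ⬝ᵥ z) := by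
  have key : ∀ (C : Matrix (Fin k) (Fin k) ℝ), C.IsHermitian →
      (∀ (μ : ℝ) (v : Fin k → ℝ), v ≠ 0 → C *ᵥ v = μ • v → 0 ≤ μ) → 0 ≤ z ⬝ᵥ (C *ᵥ z) := by
    intro C hC hμ
    have : C.PosSemidef := by
      rw [hC.posSemidef_iff_eigenvalues_nonneg]
      intro i
      refine hμ _ _ ?_ (hC.mulVec_eigenvectorBasis i)
      have := hC.eigenvectorBasis.orthonormal.ne_zero i
      simpa using this
    simpa using this.dotProduct_mulVec_nonneg z
  have hEig : ∀ (μ : ℝ) (v : Fin k → ℝ), v ≠ 0 → B *ᵥ v = μ • v → a ≤ μ ∧ μ ≤ b := by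
    intro μ v hv hBv
    refine h μ (Module.End.hasEigenvalue_of_hasEigenvector (x := v) ?_)
    rw [Module.End.hasEigenvector_iff, Module.End.mem_eigenspace_iff]
    exact ⟨by simpa using hBv, hv⟩
  have hs : ∀ c : ℝ, (c • (1 : Matrix (Fin k) (Fin k) ℝ)).IsHermitian := by
    intro c; simp [Matrix.IsHermitian]
  constructor
  · have := key (B - a • 1) (hB.sub (hs a)) (fun μ v hv hv' => by
      have := (hEig (μ + a) v hv (by
        rw [add_smul, ← hv', Matrix.sub_mulVec, Matrix.smul_mulVec, Matrix.one_mulVec]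
        simp)).1
      linarith)
    rw [Matrix.sub_mulVec, Matrix.smul_mulVec, Matrix.one_mulVec, dotProduct_sub,
      dotProduct_smul, smul_eq_mul] at this
    linarith
  · have := key (b • 1 - B) ((hs b).sub hB) (fun μ v hv hv' => by
      have := (hEig (b - μ) v hv (by
        rw [sub_smul, ← hv', Matrix.sub_mulVec, Matrix.smul_mulVec, Matrix.one_mulVec]
        simp)).2
      linarith)
    rw [Matrix.sub_mulVec, Matrix.smul_mulVec, Matrix.one_mulVec, dotProduct_sub,
      dotProduct_smul, smul_eq_mul] at this
    linarith

theorem EigenvaluesIn.inv {k : ℕ} {B : Matrix (Fin k) (Fin k) ℝ} {a b : ℝ}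
    (h : EigenvaluesIn B a b) (hB : IsUnit B) (ha : 0 < a) : EigenvaluesIn B⁻¹ b⁻¹ a⁻¹ := by
  intro μ hμ
  obtain ⟨v, hv⟩ := hμ.exists_hasEigenvector
  rw [Module.End.hasEigenvector_iff, Module.End.mem_eigenspace_iff] at hv
  obtain ⟨hv1, hv0⟩ := hv
  have hdet := (Matrix.isUnit_iff_isUnit_det B).1 hB
  rw [Matrix.toLin'_apply] at hv1
  have hBv : v = μ • (B *ᵥ v) := by
    rw [← Matrix.mulVec_smul, ← hv1, Matrix.mulVec_mulVec, Matrix.mul_nonsing_inv _ hdet,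
      Matrix.one_mulVec]
  have hμ0 : μ ≠ 0 := by
    rintro rfl; exact hv0 (by simpa using hBv)
  have := h μ⁻¹ (Module.End.hasEigenvalue_of_hasEigenvector (x := v) (by
    rw [Module.End.hasEigenvector_iff, Module.End.mem_eigenspace_iff]
    refine ⟨?_, hv0⟩
    rw [Matrix.toLin'_apply]
    conv_rhs => rw [hBv, smul_smul, inv_mul_cancel₀ hμ0, one_smul]))
  have hμi : 0 < μ⁻¹ := ha.trans_le this.1
  have hμp : 0 < μ := inv_pos.1 hμi
  exact ⟨by rw [inv_le_comm₀ (hμi.trans_le this.2) hμp]; exact this.2,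
    by rw [le_inv_comm₀ hμp ha]; exact this.1⟩

/-- Entries of a positive semidefinite matrix with quadratic form at most `b`, by polarization. -/
theorem abs_apply_le_of_quadForm {k : ℕ} {B : Matrix (Fin k) (Fin k) ℝ} {b : ℝ}
    (hB : B.IsHermitian)
    (h0 : ∀ z, 0 ≤ z ⬝ᵥ (B *ᵥ z)) (h : ∀ z, z ⬝ᵥ (B *ᵥ z) ≤ b * (z ⬝ᵥ z)) (i j : Fin k) :
    |B i j| ≤ b := by
  have hji : B j i = B i j := by simpa using hB.apply i j
  have e1 := h0 (Pi.single i 1 + Pi.single j 1)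
  have e2 := h0 (Pi.single i 1 - Pi.single j 1)
  have e3 := h (Pi.single i 1)
  have e4 := h (Pi.single j 1)
  simp [Matrix.mulVec_add, Matrix.mulVec_sub, hji] at e1 e2 e3 e4
  rw [abs_le]; constructor <;> linarith

theorem frobNorm_sq {m : ℕ} (D : Matrix (Fin m) (Fin m) ℝ) :
    frobNorm D ^ 2 = ∑ j, ∑ k, D j k ^ 2 := by
  have : (D * Dᵀ).trace = ∑ j, ∑ k, D j k ^ 2 := by
    simp [Matrix.trace, Matrix.mul_apply, sq]
  unfold frobNorm
  rw [Real.sq_sqrt, this]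
  rw [this]; positivity

theorem abs_apply_le_frobNorm {m : ℕ} (D : Matrix (Fin m) (Fin m) ℝ) (j k : Fin m) :
    |D j k| ≤ frobNorm D := by
  refine abs_le_of_sq_le_sq ?_ (Real.sqrt_nonneg _)
  rw [frobNorm_sq]
  exact (Finset.single_le_sum (f := fun k => D j k ^ 2) (fun _ _ => sq_nonneg _)
    (Finset.mem_univ k)).trans (Finset.single_le_sum (f := fun j => ∑ k, D j k ^ 2)
    (fun _ _ => Finset.sum_nonneg fun _ _ => sq_nonneg _) (Finset.mem_univ j))

/-- A bilinear form is bounded by the Frobenius norm of its matrix. -/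
theorem abs_sum_mul_mul_le {ι κ : Type*} [Fintype ι] [Fintype κ] (D : ι → κ → ℝ) {M : ℝ}
    (hM : 0 ≤ M) (hD : ∑ a, ∑ b, D a b ^ 2 ≤ M ^ 2) (u : ι → ℝ) (v : κ → ℝ) :
    |∑ a, ∑ b, D a b * (u a * v b)| ≤ M * (√(∑ a, u a ^ 2) * √(∑ b, v b ^ 2)) := by
  refine abs_le_of_sq_le_sq ?_ (by positivity)
  rw [mul_pow, mul_pow, Real.sq_sqrt (by positivity), Real.sq_sqrt (by positivity)]
  have := Finset.sum_mul_sq_le_sq_mul_sq Finset.univ (fun c : ι × κ => D c.1 c.2)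
    (fun c : ι × κ => u c.1 * v c.2)
  simp only [Fintype.sum_prod_type, mul_pow] at this
  refine this.trans ?_
  rw [← Finset.sum_mul_sum]
  exact mul_le_mul_of_nonneg_right hD (by positivity)

theorem dotProduct_mulVec_eq_sum (B : Matrix (Fin m) (Fin m) ℝ) (z : Fin m → ℝ) :
    z ⬝ᵥ (B *ᵥ z) = ∑ j, ∑ k, B j k * (z j * z k) := by
  simp only [dotProduct, Matrix.mulVec, Finset.mul_sum]
  exact Finset.sum_congr rfl fun j _ => Finset.sum_congr rfl fun k _ => by ring

theorem EigenvaluesIn.inv_bounds {B : Matrix (Fin m) (Fin m) ℝ} {c₁ c₂ : ℝ}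
    (h : EigenvaluesIn B c₁ c₂) (hB : B.PosDef) (hc₁ : 0 < c₁) (hc₂ : 0 < c₂) :
    (∀ z : Fin m → ℝ, c₂⁻¹ * ∑ j, z j ^ 2 ≤ ∑ j, ∑ k, B⁻¹ j k * (z j * z k)) ∧
      ∀ j k, |B⁻¹ j k| ≤ c₁⁻¹ := by
  have hherm : B⁻¹.IsHermitian := hB.inv.isHermitian
  have key := (h.inv hB.isUnit hc₁).quadForm_bounds hherm
  refine ⟨fun z => ?_, abs_apply_le_of_quadForm hherm (fun z => ?_) fun z => (key z).2⟩
  · have := (key z).1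
    rw [dotProduct_mulVec_eq_sum] at this
    simpa [dotProduct, sq] using this
  · refine le_trans (mul_nonneg (inv_nonneg.2 hc₂.le) ?_) (key z).1
    simp only [dotProduct, ← sq]
    positivity

theorem le_quadForm_of_frobNorm_sub_le {Q Q₀ : Matrix (Fin m) (Fin m) ℝ} {κ δ : ℝ}
    (hQ₀ : ∀ z : Fin m → ℝ, κ * ∑ j, z j ^ 2 ≤ ∑ j, ∑ k, Q₀ j k * (z j * z k))
    (h : frobNorm (Q - Q₀) ≤ δ) (z : Fin m → ℝ) :
    (κ - δ) * ∑ j, z j ^ 2 ≤ ∑ j, ∑ k, Q j k * (z j * z k) := by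
  have h0 : 0 ≤ frobNorm (Q - Q₀) := Real.sqrt_nonneg _
  have h1 := abs_sum_mul_mul_le (fun j k => (Q - Q₀) j k) h0 (frobNorm_sq _).ge z z
  rw [Real.mul_self_sqrt (by positivity)] at h1
  have h2 : ∑ j, ∑ k, (Q - Q₀) j k * (z j * z k) =
      ∑ j, ∑ k, Q j k * (z j * z k) - ∑ j, ∑ k, Q₀ j k * (z j * z k) := by
    simp only [Matrix.sub_apply, sub_mul, Finset.sum_sub_distrib]
  rw [h2] at h1
  have h3 := (abs_le.1 h1).1
  have h4 := hQ₀ z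
  have h5 : frobNorm (Q - Q₀) * ∑ j, z j ^ 2 ≤ δ * ∑ j, z j ^ 2 := by gcongr
  linarith

/-- As the inverse of a singular matrix is `0` by convention, coercivity of `R⁻¹` forces `R` to be
invertible. -/
theorem isUnit_of_le_quadForm_inv {R : Matrix (Fin m) (Fin m) ℝ} {κ : ℝ} (hκ : 0 < κ)
    (h : ∀ z : Fin m → ℝ, κ * ∑ j, z j ^ 2 ≤ ∑ j, ∑ k, R⁻¹ j k * (z j * z k)) : IsUnit R := by
  by_contra hR
  have hm : m ≠ 0 := by
    rintro rfl
    exact hR (isUnit_of_subsingleton R)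
  rw [Matrix.isUnit_iff_isUnit_det] at hR
  have := h fun _ => 1
  rw [Matrix.nonsing_inv_apply_not_isUnit _ hR] at this
  simp only [one_pow, Finset.sum_const, Finset.card_univ, Fintype.card_fin, nsmul_eq_mul,
    mul_one, Matrix.zero_apply, smul_zero] at this
  have hm' : (0 : ℝ) < m := Nat.cast_pos.2 (Nat.pos_of_ne_zero hm)
  nlinarith [mul_pos hκ hm']

section Score

variable {n m p : ℕ}

/-! ### The Gram matrix -/

theorem inner_eq_sum (u v : EuclideanSpace ℝ (Fin p)) : (inner ℝ u v : ℝ) = ∑ a, u a * v a := by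
  rw [PiLp.inner_apply]
  exact Finset.sum_congr rfl fun a _ => by simp [mul_comm]

theorem dotProduct_gram_mulVec (x : Fin n → Fin m → EuclideanSpace ℝ (Fin p))
    (u : EuclideanSpace ℝ (Fin p)) :
    u.ofLp ⬝ᵥ (gram x *ᵥ u.ofLp) = (n : ℝ)⁻¹ * ∑ i, ∑ j, inner ℝ (x i j) u ^ 2 := by
  rw [gram, Matrix.smul_mulVec, dotProduct_smul, smul_eq_mul, Matrix.sum_mulVec, dotProduct_sum]
  congr 1
  refine Finset.sum_congr rfl fun i _ => ?_
  rw [← Matrix.mulVec_mulVec, Matrix.dotProduct_mulVec, Matrix.vecMul_transpose]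
  simp only [dotProduct, Matrix.mulVec, designMatrix, Matrix.of_apply, ← sq, inner_eq_sum]

theorem isHermitian_gram (x : Fin n → Fin m → EuclideanSpace ℝ (Fin p)) :
    (gram x).IsHermitian := by
  simp [Matrix.IsHermitian, gram, Matrix.conjTranspose_eq_transpose_of_trivial,
    Matrix.transpose_sum, Matrix.transpose_mul]

theorem EigenvaluesIn.sum_inner_sq_bounds {x : Fin n → Fin m → EuclideanSpace ℝ (Fin p)}
    {b₃ b₄ : ℝ} (h : EigenvaluesIn (gram x) b₃ b₄) (hn : 0 < n) (u : EuclideanSpace ℝ (Fin p)) :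
    n * b₃ * ‖u‖ ^ 2 ≤ ∑ i, ∑ j, inner ℝ (x i j) u ^ 2 ∧
      ∑ i, ∑ j, inner ℝ (x i j) u ^ 2 ≤ n * b₄ * ‖u‖ ^ 2 := by
  have hn' : (0 : ℝ) < n := Nat.cast_pos.2 hn
  have key := h.quadForm_bounds (isHermitian_gram x) u.ofLp
  have hu : u.ofLp ⬝ᵥ u.ofLp = ‖u‖ ^ 2 := by
    rw [EuclideanSpace.norm_sq_eq]; simp [dotProduct, sq]
  rw [dotProduct_gram_mulVec, hu, inv_mul_eq_div, le_div_iff₀ hn', div_le_iff₀ hn'] at key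
  constructor <;> nlinarith [key.1, key.2]

/-! ### Zeros of strongly monotone maps -/

/-- If `-F` is strongly monotone and Lipschitz on a ball around `x₀`, and `F x₀` is small compared
with the radius, then the damped iteration `x ↦ x + τ F x` from `x₀` converges to a zero of `F` in
the ball. With `τ = c / L²` the iteration contracts by the factor `√(1 - c² / L²)`. -/
theorem exists_zero_of_stronglyMonotone {E : Type*} [NormedAddCommGroup E]
    [InnerProductSpace ℝ E] [CompleteSpace E] {F : E → E} {x₀ : E} {r c L : ℝ}
    (hr : 0 ≤ r) (hc : 0 < c) (hcL : c ≤ L)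
    (hmono : ∀ x ∈ Metric.closedBall x₀ r, ∀ y ∈ Metric.closedBall x₀ r,
      c * ‖x - y‖ ^ 2 ≤ inner ℝ (x - y) (F y - F x))
    (hlip : ∀ x ∈ Metric.closedBall x₀ r, ∀ y ∈ Metric.closedBall x₀ r,
      ‖F x - F y‖ ≤ L * ‖x - y‖)
    (h₀ : c / L ^ 2 * ‖F x₀‖ ≤ (1 - √(1 - c ^ 2 / L ^ 2)) * r) :
    ∃ z ∈ Metric.closedBall x₀ r, F z = 0 ∧
      Tendsto (fun k => (fun x => x + (c / L ^ 2) • F x)^[k] x₀) atTop (𝓝 z) := by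
  have hL : 0 < L := hc.trans_le hcL
  set K : ℝ := √(1 - c ^ 2 / L ^ 2) with hK
  set S : Set E := Metric.closedBall x₀ r
  set f : E → E := fun x => x + (c / L ^ 2) • F x with hf
  have hle : c ^ 2 / L ^ 2 ≤ 1 := by
    rw [div_le_one (by positivity)]; gcongr
  have hK0 : 0 ≤ K := Real.sqrt_nonneg _
  have hK1 : K < 1 := by
    rw [hK, Real.sqrt_lt' one_pos]
    have : 0 < c ^ 2 / L ^ 2 := by positivity
    linarith
  have hcontr : ∀ x ∈ S, ∀ y ∈ S, ‖f x - f y‖ ≤ K * ‖x - y‖ := by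
    intro x hx y hy
    refine (le_abs_self _).trans (abs_le_of_sq_le_sq ?_ (by positivity))
    have e : f x - f y = (x - y) - (c / L ^ 2) • (F y - F x) := by
      simp only [hf, smul_sub]; abel
    rw [e, norm_sub_sq_real, inner_smul_right, norm_smul, mul_pow, Real.norm_eq_abs, sq_abs,
      mul_pow, hK, Real.sq_sqrt (by linarith)]
    have h1 := hmono x hx y hy
    have h2 : ‖F y - F x‖ ^ 2 ≤ L ^ 2 * ‖x - y‖ ^ 2 := by
      rw [norm_sub_rev, ← mul_pow]
      exact pow_le_pow_left₀ (norm_nonneg _) (hlip x hx y hy) 2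
    have h3 := mul_le_mul_of_nonneg_left h1 (show 0 ≤ 2 * (c / L ^ 2) by positivity)
    have h4 := mul_le_mul_of_nonneg_left h2 (show 0 ≤ (c / L ^ 2) ^ 2 by positivity)
    have h5 : (c / L ^ 2) ^ 2 * (L ^ 2 * ‖x - y‖ ^ 2) = c ^ 2 / L ^ 2 * ‖x - y‖ ^ 2 := by
      field_simp
    have h6 : 2 * (c / L ^ 2) * (c * ‖x - y‖ ^ 2) = 2 * (c ^ 2 / L ^ 2 * ‖x - y‖ ^ 2) := by
      field_simp
    linarith
  have hx₀ : x₀ ∈ S := Metric.mem_closedBall_self hr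
  have hmaps : Set.MapsTo f S S := by
    intro x hx
    rw [Metric.mem_closedBall, dist_eq_norm]
    have h1 := hcontr x hx x₀ hx₀
    have h2 : ‖f x₀ - x₀‖ ≤ (1 - K) * r := by
      simp only [hf, add_sub_cancel_left, norm_smul, Real.norm_eq_abs]
      rwa [abs_of_nonneg (by positivity)]
    have h3 : ‖x - x₀‖ ≤ r := mem_closedBall_iff_norm.1 hx
    calc ‖f x - x₀‖ = ‖(f x - f x₀) + (f x₀ - x₀)‖ := by congr 1; abel
      _ ≤ K * r + (1 - K) * r := (norm_add_le _ _).trans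
          (add_le_add (h1.trans (mul_le_mul_of_nonneg_left h3 hK0)) h2)
      _ = r := by ring
  have hcw : ContractingWith ⟨K, hK0⟩ (hmaps.restrict f S S) := by
    refine ⟨by exact_mod_cast hK1, LipschitzWith.of_dist_le_mul fun a b => ?_⟩
    rw [Subtype.dist_eq, Subtype.dist_eq, dist_eq_norm, dist_eq_norm]
    exact hcontr a a.2 b b.2
  obtain ⟨z, hz, hfz, hlim, -⟩ := hcw.exists_fixedPoint' Metric.isClosed_closedBall.isComplete
    hmaps hx₀ (edist_ne_top _ _)
  refine ⟨z, hz, ?_, hlim⟩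
  have : (c / L ^ 2) • F z = 0 := by simpa [hf, Function.IsFixedPt] using hfz
  exact (smul_eq_zero.1 this).resolve_left (by positivity)

/-! ### Strong monotonicity of the estimating function -/

/-- The estimating function as a vector of the Euclidean space, in terms of the inverse `Q` of the
working correlation matrix and with `A^{-1/2} (y - π)` written as Pearson residuals. -/
noncomputable def scoreVec {n m p : ℕ} (x : Fin n → Fin m → EuclideanSpace ℝ (Fin p))
    (y : Fin n → Fin m → ℝ) (Q : Matrix (Fin m) (Fin m) ℝ) (β : EuclideanSpace ℝ (Fin p)) :
    EuclideanSpace ℝ (Fin p) :=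
  ∑ i, ∑ j, ∑ k,
    (Q j k * (stdDev (inner ℝ (x i j) β) * pearson (y i k) (inner ℝ (x i k) β))) • x i j

variable {x : Fin n → Fin m → EuclideanSpace ℝ (Fin p)} {y : Fin n → Fin m → ℝ}
  {Q : Matrix (Fin m) (Fin m) ℝ}

theorem score_eq (R : Matrix (Fin m) (Fin m) ℝ) (β : EuclideanSpace ℝ (Fin p)) :
    score x y R β = (scoreVec x y R⁻¹ β).ofLp := by
  have hs : ∀ v : EuclideanSpace ℝ (Fin p), √(margVar v β) = stdDev (inner ℝ v β) :=
    fun v => sqrt_logistic_var (inner ℝ v β)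
  ext a
  simp only [score, scoreVec, Finset.sum_apply, ← Matrix.mulVec_mulVec, sqrtVar, invSqrtVar, hs,
    WithLp.ofLp_sum, WithLp.ofLp_smul, Pi.smul_apply, smul_eq_mul]
  refine Finset.sum_congr rfl fun i _ => ?_
  simp only [Matrix.mulVec, dotProduct, designMatrix,
    Matrix.transpose_apply, Matrix.of_apply, Matrix.diagonal_apply, ite_mul, zero_mul,
    Finset.sum_ite_eq, Finset.mem_univ, if_true]
  refine Finset.sum_congr rfl fun j _ => ?_
  rw [Finset.mul_sum, Finset.mul_sum]
  refine Finset.sum_congr rfl fun k _ => ?_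
  rw [← inv_stdDev_mul_sub_logistic]
  change _ * (_ * (_ * (_ * (y i k - logistic (inner ℝ (x i k) β))))) = _
  ring

theorem inner_scoreVec (u β : EuclideanSpace ℝ (Fin p)) :
    inner ℝ u (scoreVec x y Q β) = ∑ i, ∑ j, ∑ k,
      Q j k * (stdDev (inner ℝ (x i j) β) * pearson (y i k) (inner ℝ (x i k) β)) *
        inner ℝ (x i j) u := by
  simp only [scoreVec, inner_sum, inner_smul_right, real_inner_comm u]

theorem inner_scoreVec_sub (u β β' : EuclideanSpace ℝ (Fin p)) :
    inner ℝ u (scoreVec x y Q β - scoreVec x y Q β') = ∑ i, ∑ j, ∑ k,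
      Q j k * (stdDev (inner ℝ (x i j) β) * pearson (y i k) (inner ℝ (x i k) β) -
        stdDev (inner ℝ (x i j) β') * pearson (y i k) (inner ℝ (x i k) β')) *
        inner ℝ (x i j) u := by
  rw [inner_sub_right, inner_scoreVec, inner_scoreVec]
  simp only [← Finset.sum_sub_distrib]
  refine Finset.sum_congr rfl fun i _ => Finset.sum_congr rfl fun j _ =>
    Finset.sum_congr rfl fun k _ => ?_
  ring

/-- The Cauchy–Schwarz estimate behind both the Lipschitz bound and the remainder of the
linearization: `b` bounds the unnormalized Gram matrix. -/
theorem abs_weighted_sum_le {b q ℓ : ℝ} (hb : 0 ≤ b) (hq : 0 ≤ q) (hℓ : 0 ≤ ℓ)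
    (hgram : ∀ u, ∑ i, ∑ j, inner ℝ (x i j) u ^ 2 ≤ b * ‖u‖ ^ 2)
    (hQ : ∀ j k, |Q j k| ≤ q) {u d : EuclideanSpace ℝ (Fin p)} {e : Fin n → Fin m → Fin m → ℝ}
    (he : ∀ i j k, |e i j k| ≤ ℓ * (|inner ℝ (x i j) d| + |inner ℝ (x i k) d|)) :
    |∑ i, ∑ j, ∑ k, Q j k * e i j k * inner ℝ (x i j) u| ≤
      2 * q * ℓ * m * b * (‖u‖ * ‖d‖) := by
  have cs : ∀ g h : Fin n → Fin m → Fin m → ℝ, ∑ i, ∑ j, ∑ k, g i j k ^ 2 ≤ m * b * ‖u‖ ^ 2 →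
      ∑ i, ∑ j, ∑ k, h i j k ^ 2 ≤ m * b * ‖d‖ ^ 2 →
      ∑ i, ∑ j, ∑ k, g i j k * h i j k ≤ m * b * (‖u‖ * ‖d‖) := by
    intro g h hg hh
    refine (le_abs_self _).trans (abs_le_of_sq_le_sq ?_ (by positivity))
    have := Finset.sum_mul_sq_le_sq_mul_sq Finset.univ
      (fun c : Fin n × Fin m × Fin m => g c.1 c.2.1 c.2.2)
      (fun c : Fin n × Fin m × Fin m => h c.1 c.2.1 c.2.2)
    simp only [Fintype.sum_prod_type] at this
    refine this.trans ((mul_le_mul hg hh (by positivity) (by positivity)).trans_eq ?_)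
    ring
  have h1 : ∀ u, ∑ i, ∑ j, ∑ _k : Fin m, |inner ℝ (x i j) u| ^ 2 ≤ m * b * ‖u‖ ^ 2 := by
    intro u
    simp only [sq_abs, Finset.sum_const, Finset.card_univ, Fintype.card_fin, nsmul_eq_mul,
      ← Finset.mul_sum]
    rw [mul_assoc]
    exact mul_le_mul_of_nonneg_left (hgram u) (Nat.cast_nonneg _)
  have h2 : ∀ u, ∑ i, ∑ _j : Fin m, ∑ k, |inner ℝ (x i k) u| ^ 2 ≤ m * b * ‖u‖ ^ 2 := by
    intro u
    simp only [sq_abs, Finset.sum_const, Finset.card_univ, Fintype.card_fin, nsmul_eq_mul,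
      ← Finset.mul_sum]
    rw [mul_assoc]
    exact mul_le_mul_of_nonneg_left (hgram u) (Nat.cast_nonneg _)
  have e1 := cs _ _ (h1 u) (h1 d)
  have e2 := cs _ _ (h1 u) (h2 d)
  calc |∑ i, ∑ j, ∑ k, Q j k * e i j k * inner ℝ (x i j) u|
      ≤ ∑ i, ∑ j, ∑ k, |Q j k * e i j k * inner ℝ (x i j) u| := by
        refine (Finset.abs_sum_le_sum_abs _ _).trans (Finset.sum_le_sum fun i _ => ?_)
        refine (Finset.abs_sum_le_sum_abs _ _).trans (Finset.sum_le_sum fun j _ => ?_)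
        exact Finset.abs_sum_le_sum_abs _ _
    _ ≤ ∑ i, ∑ j, ∑ k, q * ℓ * (|inner ℝ (x i j) u| * |inner ℝ (x i j) d| +
          |inner ℝ (x i j) u| * |inner ℝ (x i k) d|) := by
        gcongr with i _ j _ k _
        rw [abs_mul, abs_mul]
        calc |Q j k| * |e i j k| * |inner ℝ (x i j) u|
            ≤ q * (ℓ * (|inner ℝ (x i j) d| + |inner ℝ (x i k) d|)) * |inner ℝ (x i j) u| := by
              gcongr
              · exact hQ j k
              · exact he i j k
          _ = _ := by ring
    _ = q * ℓ * (∑ i, ∑ j, ∑ _k : Fin m, |inner ℝ (x i j) u| * |inner ℝ (x i j) d| +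
          ∑ i, ∑ j, ∑ k, |inner ℝ (x i j) u| * |inner ℝ (x i k) d|) := by
        simp only [← Finset.mul_sum (a := q * ℓ)]
        simp only [Finset.sum_add_distrib]
    _ ≤ q * ℓ * (m * b * (‖u‖ * ‖d‖) + m * b * (‖u‖ * ‖d‖)) := by gcongr
    _ = _ := by ring

theorem norm_scoreVec_sub_le {b q T L : ℝ} (hb : 0 ≤ b) (hq : 0 ≤ q) (hL : 0 ≤ L)
    (hgram : ∀ u, ∑ i, ∑ j, inner ℝ (x i j) u ^ 2 ≤ b * ‖u‖ ^ 2)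
    (hQ : ∀ j k, |Q j k| ≤ q) (hy : ∀ i k, y i k = 0 ∨ y i k = 1)
    (hT : SummandBound T L)
    {β β' : EuclideanSpace ℝ (Fin p)}
    (hβ : ∀ i j, inner ℝ (x i j) β ∈ Set.Icc (-T) T)
    (hβ' : ∀ i j, inner ℝ (x i j) β' ∈ Set.Icc (-T) T) :
    ‖scoreVec x y Q β - scoreVec x y Q β'‖ ≤ 2 * q * L * m * b * ‖β - β'‖ := by
  set v := scoreVec x y Q β - scoreVec x y Q β' with hv
  have h : inner ℝ v v ≤ 2 * q * L * m * b * (‖v‖ * ‖β - β'‖) := by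
    conv_lhs => rw [hv, inner_scoreVec_sub, ← hv]
    refine (le_abs_self _).trans (abs_weighted_sum_le hb hq hL hgram hQ fun i j k => ?_)
    rw [inner_sub_right, inner_sub_right]
    exact hT.lipschitz _ (hy i k) _ (hβ i j) _ (hβ' i j) _ (hβ i k) _ (hβ' i k)
  rw [real_inner_self_eq_norm_sq] at h
  rcases (norm_nonneg v).eq_or_lt with h0 | h0
  · rw [← h0]; positivity
  · refine le_of_mul_le_mul_left ?_ h0
    linarith

/-- Strong monotonicity of minus the estimating function near `β₀`. The bounds `ν` control the two
mean-zero parts of its linearization at `β₀`, coming from the derivatives of `A^{1/2}` and of the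
Pearson residuals. -/
theorem le_inner_scoreVec_sub {a b q T L ρ κ w ν : ℝ} (hb : 0 ≤ b) (hq : 0 ≤ q) (hL : 0 ≤ L)
    (hκ : 0 ≤ κ) (hw : 0 ≤ w) (hρ : 0 ≤ ρ) {β₀ β β' : EuclideanSpace ℝ (Fin p)}
    (hgram₀ : a * ‖β - β'‖ ^ 2 ≤ ∑ i, ∑ j, inner ℝ (x i j) (β - β') ^ 2)
    (hgram : ∀ u, ∑ i, ∑ j, inner ℝ (x i j) u ^ 2 ≤ b * ‖u‖ ^ 2)
    (hQ : ∀ j k, |Q j k| ≤ q)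
    (hQpos : ∀ z : Fin m → ℝ, κ * ∑ j, z j ^ 2 ≤ ∑ j, ∑ k, Q j k * (z j * z k))
    (hy : ∀ i k, y i k = 0 ∨ y i k = 1)
    (hT : SummandBound T L)
    (hβ₀ : ∀ i j, inner ℝ (x i j) β₀ ∈ Set.Icc (-T) T)
    (hβ : ∀ i j, inner ℝ (x i j) β ∈ Set.Icc (-T) T)
    (hβ' : ∀ i j, inner ℝ (x i j) β' ∈ Set.Icc (-T) T)
    (hβρ : ∀ i j, |(inner ℝ (x i j) β : ℝ) - inner ℝ (x i j) β₀| ≤ ρ)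
    (hβρ' : ∀ i j, |(inner ℝ (x i j) β' : ℝ) - inner ℝ (x i j) β₀| ≤ ρ)
    (hws : ∀ i j, w ≤ stdDev (inner ℝ (x i j) β₀))
    (hA : ∀ j k, |∑ i, stdDevDeriv (inner ℝ (x i j) β₀) *
      pearson (y i k) (inner ℝ (x i k) β₀) *
        (inner ℝ (x i j) (β - β') * inner ℝ (x i j) (β - β'))| ≤ ν * ‖β - β'‖ ^ 2)
    (hB : ∀ j k, |∑ i, stdDev (inner ℝ (x i j) β₀) *
      (pearsonDeriv (y i k) (inner ℝ (x i k) β₀) + stdDev (inner ℝ (x i k) β₀)) *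
        (inner ℝ (x i j) (β - β') * inner ℝ (x i k) (β - β'))| ≤ ν * ‖β - β'‖ ^ 2) :
    (κ * w ^ 2 * a - 2 * m ^ 2 * q * ν - 2 * q * (L * ρ) * m * b) * ‖β - β'‖ ^ 2 ≤
      inner ℝ (β - β') (scoreVec x y Q β' - scoreVec x y Q β) := by
  set d := β - β' with hd
  set s : Fin n → Fin m → ℝ := fun i j => inner ℝ (x i j) β₀ with hs
  set D : Fin n → Fin m → ℝ := fun i j => inner ℝ (x i j) d with hD
  set e : Fin n → Fin m → Fin m → ℝ := fun i j k =>
    stdDev (inner ℝ (x i j) β) * pearson (y i k) (inner ℝ (x i k) β) -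
      stdDev (inner ℝ (x i j) β') * pearson (y i k) (inner ℝ (x i k) β') -
      (stdDevDeriv (s i j) * pearson (y i k) (s i k) * D i j +
        stdDev (s i j) * pearsonDeriv (y i k) (s i k) * D i k) with he
  have hDsub : ∀ i j, D i j = inner ℝ (x i j) β - inner ℝ (x i j) β' := fun i j => by
    rw [hD, hd]; exact inner_sub_right _ _ _
  -- the remainder of the linearization
  have h1 : |∑ i, ∑ j, ∑ k, Q j k * e i j k * D i j| ≤
      2 * q * (L * ρ) * m * b * (‖d‖ * ‖d‖) := by
    refine abs_weighted_sum_le hb hq (by positivity) hgram hQ fun i j k => ?_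
    change |e i j k| ≤ L * ρ * (|D i j| + |D i k|)
    rw [he]
    simp only [hDsub]
    exact hT.taylor _ (hy i k) _ (hβ i j) _ (hβ' i j) _ (hβ i k) _ (hβ' i k) _ (hβ₀ i j) _ (hβ₀ i k)
      ρ (hβρ i j) (hβρ' i j) (hβρ i k) (hβρ' i k)
  -- the two mean-zero terms
  have noise : ∀ N : Fin m → Fin m → ℝ, (∀ j k, |N j k| ≤ ν * ‖d‖ ^ 2) →
      ∑ j, ∑ k, Q j k * N j k ≤ m ^ 2 * q * (ν * ‖d‖ ^ 2) := by
    intro N hN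
    calc ∑ j, ∑ k, Q j k * N j k ≤ ∑ _j : Fin m, ∑ _k : Fin m, q * (ν * ‖d‖ ^ 2) := by
          refine Finset.sum_le_sum fun j _ => Finset.sum_le_sum fun k _ => ?_
          refine (le_abs_self _).trans ?_
          rw [abs_mul]
          exact mul_le_mul (hQ j k) (hN j k) (abs_nonneg _) hq
      _ = _ := by simp; ring
  have h2 := noise _ hA
  have h3 := noise _ hB
  -- the leading term
  have h4 : κ * w ^ 2 * (a * ‖d‖ ^ 2) ≤
      ∑ i, ∑ j, ∑ k, Q j k * ((stdDev (s i j) * D i j) * (stdDev (s i k) * D i k)) := by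
    calc κ * w ^ 2 * (a * ‖d‖ ^ 2) ≤ κ * w ^ 2 * ∑ i, ∑ j, D i j ^ 2 := by gcongr
      _ = ∑ i, κ * ∑ j, w ^ 2 * D i j ^ 2 := by
          simp only [← Finset.mul_sum, mul_assoc]
      _ ≤ ∑ i, κ * ∑ j, (stdDev (s i j) * D i j) ^ 2 := by
          gcongr with i _ j _
          rw [mul_pow]
          gcongr
          exact hws i j
      _ ≤ _ := Finset.sum_le_sum fun i _ => hQpos fun j => stdDev (s i j) * D i j
  have swap : ∀ g : Fin n → Fin m → Fin m → ℝ,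
      ∑ j, ∑ k, Q j k * ∑ i, g i j k = ∑ i, ∑ j, ∑ k, Q j k * g i j k := by
    intro g
    simp only [Finset.mul_sum]
    rw [Finset.sum_comm]
    rw [Finset.sum_comm]
    conv_rhs => rw [Finset.sum_comm]
    refine Finset.sum_congr rfl fun j _ => ?_
    rw [Finset.sum_comm]
  rw [swap] at h2 h3
  have h5 : inner ℝ d (scoreVec x y Q β' - scoreVec x y Q β) =
      ∑ i, ∑ j, ∑ k, Q j k * ((stdDev (s i j) * D i j) * (stdDev (s i k) * D i k))
      - ∑ i, ∑ j, ∑ k, Q j k * (stdDevDeriv (s i j) * pearson (y i k) (s i k) *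
          (D i j * D i j))
      - ∑ i, ∑ j, ∑ k, Q j k * (stdDev (s i j) *
          (pearsonDeriv (y i k) (s i k) + stdDev (s i k)) * (D i j * D i k))
      - ∑ i, ∑ j, ∑ k, Q j k * e i j k * D i j := by
    rw [inner_scoreVec_sub]
    simp only [← Finset.sum_sub_distrib]
    refine Finset.sum_congr rfl fun i _ => Finset.sum_congr rfl fun j _ =>
      Finset.sum_congr rfl fun k _ => ?_
    simp only [he]
    change _ * _ * D i j = _
    ring
  rw [h5]
  have := (abs_le.1 h1).2
  nlinarith [h2, h3, h4, this]

end Score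

section Zero

variable {n m p : ℕ}

/-! ### Existence of a zero when the noise is small -/

/-- The random matrices and vectors in the linearized estimating function have their expected order
of magnitude, up to the factor `G`: the score at `β₀`, and the mean-zero parts of the derivative
that come from differentiating `A^{1/2}` on the left and the Pearson residual on the right. All
norms are Frobenius norms, expressed as sums over coordinates. -/
structure NoiseBound (x : Fin n → Fin m → EuclideanSpace ℝ (Fin p)) (y : Fin n → Fin m → ℝ)
    (β₀ : EuclideanSpace ℝ (Fin p)) (G : ℝ) : Prop where
  score : ∀ j k, ∑ a, (∑ i, stdDev (inner ℝ (x i j) β₀) * (stdDev (inner ℝ (x i k) β₀))⁻¹ *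
    x i j a * (y i k - prob (x i k) β₀)) ^ 2 ≤ G ^ 2 * (n * p)
  leftDeriv : ∀ j k, ∑ c : Fin p × Fin p, (∑ i, stdDevDeriv (inner ℝ (x i j) β₀) *
    (stdDev (inner ℝ (x i k) β₀))⁻¹ * (x i j c.1 * x i j c.2) * (y i k - prob (x i k) β₀)) ^ 2 ≤
      G ^ 2 * (n * p ^ 2)
  rightDeriv : ∀ j k, ∑ c : Fin p × Fin p, (∑ i, stdDev (inner ℝ (x i j) β₀) *
    Real.sinh (inner ℝ (x i k) β₀ / 2) * (x i j c.1 * x i k c.2) *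
      (y i k - prob (x i k) β₀)) ^ 2 ≤ G ^ 2 * (n * p ^ 2)

theorem abs_sum_mul_inner_mul_inner_le {g : Fin n → ℝ} {u v : Fin n → EuclideanSpace ℝ (Fin p)}
    {M : ℝ} (hM : 0 ≤ M)
    (h : ∑ c : Fin p × Fin p, (∑ i, g i * (u i c.1 * v i c.2)) ^ 2 ≤ M ^ 2)
    (d : EuclideanSpace ℝ (Fin p)) :
    |∑ i, g i * (inner ℝ (u i) d * inner ℝ (v i) d)| ≤ M * ‖d‖ ^ 2 := by
  rw [Fintype.sum_prod_type] at h
  have key := abs_sum_mul_mul_le (fun a b => ∑ i, g i * (u i a * v i b)) hM h d d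
  have hd : √(∑ a, d a ^ 2) = ‖d‖ := by simp [EuclideanSpace.norm_eq]
  rw [hd, ← sq] at key
  convert key using 2
  have hi : ∀ i, g i * (inner ℝ (u i) d * inner ℝ (v i) d) =
      ∑ a, ∑ b, g i * (u i a * v i b) * (d a * d b) := by
    intro i
    rw [inner_eq_sum, inner_eq_sum, Finset.sum_mul_sum, Finset.mul_sum]
    refine Finset.sum_congr rfl fun a _ => ?_
    rw [Finset.mul_sum]
    exact Finset.sum_congr rfl fun b _ => by ring
  simp only [hi, Finset.sum_mul]
  rw [Finset.sum_comm]
  exact Finset.sum_congr rfl fun a _ => Finset.sum_comm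

theorem NoiseBound.norm_scoreVec_le {x : Fin n → Fin m → EuclideanSpace ℝ (Fin p)}
    {y : Fin n → Fin m → ℝ} {β₀ : EuclideanSpace ℝ (Fin p)} {G : ℝ} (h : NoiseBound x y β₀ G)
    (hG : 0 ≤ G) {Q : Matrix (Fin m) (Fin m) ℝ} {q : ℝ} (hQ : ∀ j k, |Q j k| ≤ q) (hq : 0 ≤ q) :
    ‖scoreVec x y Q β₀‖ ≤ m ^ 2 * q * (G * √(n * p)) := by
  set N : Fin m → Fin m → EuclideanSpace ℝ (Fin p) := fun j k =>
    ∑ i, (stdDev (inner ℝ (x i j) β₀) * pearson (y i k) (inner ℝ (x i k) β₀)) • x i j with hN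
  have hNle : ∀ j k, ‖N j k‖ ≤ G * √(n * p) := by
    intro j k
    refine (le_abs_self _).trans (abs_le_of_sq_le_sq ?_ (by positivity))
    rw [mul_pow, Real.sq_sqrt (by positivity), EuclideanSpace.norm_sq_eq]
    refine le_trans (le_of_eq ?_) (h.score j k)
    refine Finset.sum_congr rfl fun a _ => ?_
    rw [Real.norm_eq_abs, sq_abs]
    congr 1
    simp only [hN, WithLp.ofLp_sum, WithLp.ofLp_smul, Finset.sum_apply, Pi.smul_apply,
      smul_eq_mul]
    refine Finset.sum_congr rfl fun i _ => ?_
    rw [← inv_stdDev_mul_sub_logistic]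
    change _ = _ * _ * _ * (y i k - logistic (inner ℝ (x i k) β₀))
    ring
  have hs : scoreVec x y Q β₀ = ∑ j, ∑ k, Q j k • N j k := by
    simp only [scoreVec, hN, Finset.smul_sum, smul_smul]
    rw [Finset.sum_comm]
    exact Finset.sum_congr rfl fun j _ => Finset.sum_comm
  calc ‖scoreVec x y Q β₀‖ ≤ ∑ _j : Fin m, ∑ _k : Fin m, q * (G * √(n * p)) := by
        rw [hs]
        refine norm_sum_le_of_le _ fun j _ => norm_sum_le_of_le _ fun k _ => ?_
        rw [norm_smul]
        exact mul_le_mul (hQ j k) (hNle j k) (norm_nonneg _) hq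
    _ = _ := by simp; ring

/-- The deterministic core: for responses whose noise is of the expected order, and `p / √n` small,
the damped iteration started at `β₀` converges to a zero of the estimating function within
`M √(p / n)` of `β₀`. The step size depends only on `c` and `lip`, not on the noise level `G`. -/
theorem exists_zero_scoreVec (hn : 0 < n) {x : Fin n → Fin m → EuclideanSpace ℝ (Fin p)}
    {y : Fin n → Fin m → ℝ} {β₀ : EuclideanSpace ℝ (Fin p)} {Q : Matrix (Fin m) (Fin m) ℝ}
    {C T L b₃ b₄ κ q w G M c lip : ℝ} (hC : 0 ≤ C) (hL : 0 ≤ L) (hb₄ : 0 ≤ b₄)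
    (hκ : 0 ≤ κ) (hq : 0 ≤ q) (hw : 0 ≤ w) (hG : 0 ≤ G) (hM : 0 ≤ M)
    (hx : ∀ i j, ‖x i j‖ ≤ C * √p) (hβ₀ : ∀ i j, |(inner ℝ (x i j) β₀ : ℝ)| ≤ T)
    (hgram₀ : ∀ u, n * b₃ * ‖u‖ ^ 2 ≤ ∑ i, ∑ j, inner ℝ (x i j) u ^ 2)
    (hgram : ∀ u, ∑ i, ∑ j, inner ℝ (x i j) u ^ 2 ≤ n * b₄ * ‖u‖ ^ 2)
    (hQ : ∀ j k, |Q j k| ≤ q)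
    (hQpos : ∀ z : Fin m → ℝ, κ * ∑ j, z j ^ 2 ≤ ∑ j, ∑ k, Q j k * (z j * z k))
    (hy : ∀ i k, y i k = 0 ∨ y i k = 1)
    (hT : SummandBound (T + 1) L)
    (hws : ∀ i j, w ≤ stdDev (inner ℝ (x i j) β₀))
    (hnoise : NoiseBound x y β₀ G)
    (hρ : C * M * (p / √n) ≤ 1) (hc : 0 < c)
    (hcle : c ≤ κ * w ^ 2 * b₃ - 2 * m ^ 2 * q * (G * (p / √n)) -
      2 * q * (L * (C * M * (p / √n))) * m * b₄)
    (hclip : c ≤ lip) (hlip : 2 * q * L * m * b₄ ≤ lip)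
    (hMle : c / lip ^ 2 * (m ^ 2 * q * G) ≤ (1 - √(1 - c ^ 2 / lip ^ 2)) * M) :
    ∃ z ∈ Metric.closedBall β₀ (M * √((p : ℝ) / n)), scoreVec x y Q z = 0 ∧
      Tendsto (fun k => (fun β => β + (c / lip ^ 2) • ((n : ℝ)⁻¹ • scoreVec x y Q β))^[k] β₀)
        atTop (𝓝 z) := by
  have hn' : (0 : ℝ) < n := Nat.cast_pos.2 hn
  have hsp2 : √(p : ℝ) * √p = p := Real.mul_self_sqrt (Nat.cast_nonneg _)
  set ρ := C * M * (p / √n) with hρdef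
  have hρ0 : 0 ≤ ρ := by positivity
  have hnear : ∀ β ∈ Metric.closedBall β₀ (M * √((p : ℝ) / n)), ∀ i j,
      |(inner ℝ (x i j) β : ℝ) - inner ℝ (x i j) β₀| ≤ ρ := by
    intro β hβ i j
    rw [← inner_sub_right]
    refine (abs_real_inner_le_norm _ _).trans ?_
    refine (mul_le_mul (hx i j) (mem_closedBall_iff_norm.1 hβ) (norm_nonneg _)
      (by positivity)).trans_eq ?_
    rw [Real.sqrt_div (Nat.cast_nonneg _), hρdef]
    calc C * √p * (M * (√p / √n)) = C * M * ((√p * √p) / √n) := by ring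
      _ = _ := by rw [hsp2]
  have hmem₀ : ∀ i j, (inner ℝ (x i j) β₀ : ℝ) ∈ Set.Icc (-(T + 1)) (T + 1) := by
    intro i j
    have := abs_le.1 (hβ₀ i j)
    constructor <;> linarith
  have hmem : ∀ β ∈ Metric.closedBall β₀ (M * √((p : ℝ) / n)), ∀ i j,
      (inner ℝ (x i j) β : ℝ) ∈ Set.Icc (-(T + 1)) (T + 1) := by
    intro β hβ i j
    have h1 := abs_le.1 (hβ₀ i j)
    have h2 := abs_le.1 ((hnear β hβ i j).trans hρ)
    constructor <;> linarith
  have hnoiseM : ∀ {t : ℝ}, t ≤ G ^ 2 * (n * p ^ 2) → t ≤ (n * (G * (p / √n))) ^ 2 := by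
    intro t ht
    refine ht.trans_eq ?_
    rw [mul_pow, mul_pow, div_pow, Real.sq_sqrt hn'.le]
    field_simp
  have hnorm : ∀ v : EuclideanSpace ℝ (Fin p), ‖(n : ℝ)⁻¹ • v‖ = (n : ℝ)⁻¹ * ‖v‖ := fun v => by
    rw [norm_smul, Real.norm_eq_abs, abs_of_pos (by positivity)]
  suffices h : ∃ z ∈ Metric.closedBall β₀ (M * √((p : ℝ) / n)),
      (n : ℝ)⁻¹ • scoreVec x y Q z = 0 ∧
      Tendsto (fun k => (fun β => β + (c / lip ^ 2) • ((n : ℝ)⁻¹ • scoreVec x y Q β))^[k] β₀)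
        atTop (𝓝 z) by
    obtain ⟨z, hz, hz0, hlim⟩ := h
    exact ⟨z, hz, (smul_eq_zero.1 hz0).resolve_left (by positivity), hlim⟩
  refine exists_zero_of_stronglyMonotone (F := fun β => (n : ℝ)⁻¹ • scoreVec x y Q β)
    (by positivity) hc hclip ?_ ?_ ?_
  · intro β hβ β' hβ'
    have key := le_inner_scoreVec_sub (a := n * b₃) (b := n * b₄) (ν := n * (G * (p / √n)))
      (by positivity) hq hL hκ hw hρ0
      (hgram₀ (β - β')) hgram hQ hQpos hy hT
      hmem₀ (hmem β hβ) (hmem β' hβ') (hnear β hβ) (hnear β' hβ') hws ?_ ?_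
    · rw [← smul_sub, inner_smul_right]
      have h1 : c * ‖β - β'‖ ^ 2 ≤ (n : ℝ)⁻¹ * ((κ * w ^ 2 * (n * b₃) -
          2 * m ^ 2 * q * (n * (G * (p / √n))) - 2 * q * (L * ρ) * m * (n * b₄)) *
          ‖β - β'‖ ^ 2) := by
        refine (mul_le_mul_of_nonneg_right hcle (sq_nonneg _)).trans_eq ?_
        field_simp
      exact h1.trans (mul_le_mul_of_nonneg_left key (by positivity))
    · intro j k
      refine le_trans (le_of_eq ?_) (abs_sum_mul_inner_mul_inner_le
        (u := fun i => x i j) (v := fun i => x i j)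
        (g := fun i => stdDevDeriv (inner ℝ (x i j) β₀) * (stdDev (inner ℝ (x i k) β₀))⁻¹ *
          (y i k - prob (x i k) β₀)) (by positivity)
        (hnoiseM (le_trans (le_of_eq ?_) (hnoise.leftDeriv j k))) (β - β'))
      · congr 1
        refine Finset.sum_congr rfl fun i _ => ?_
        rw [← inv_stdDev_mul_sub_logistic]
        change _ = _ * (y i k - logistic (inner ℝ (x i k) β₀)) * _
        ring
      · refine Finset.sum_congr rfl fun a _ => ?_
        congr 1
        exact Finset.sum_congr rfl fun i _ => by ring
    · intro j k
      refine le_trans (le_of_eq ?_) (abs_sum_mul_inner_mul_inner_le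
        (u := fun i => x i j) (v := fun i => x i k)
        (g := fun i => stdDev (inner ℝ (x i j) β₀) * Real.sinh (inner ℝ (x i k) β₀ / 2) *
          (y i k - prob (x i k) β₀)) (by positivity)
        (hnoiseM (le_trans (le_of_eq ?_) (hnoise.rightDeriv j k))) (β - β'))
      · congr 1
        refine Finset.sum_congr rfl fun i _ => ?_
        rw [pearsonDeriv_add_stdDev]
        change _ = _ * (y i k - logistic (inner ℝ (x i k) β₀)) * _
        ring
      · refine Finset.sum_congr rfl fun a _ => ?_
        congr 1
        exact Finset.sum_congr rfl fun i _ => by ring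
  · intro β hβ β' hβ'
    have key := norm_scoreVec_sub_le (b := n * b₄) (by positivity) hq hL hgram hQ hy hT
      (hmem β hβ) (hmem β' hβ')
    rw [← smul_sub, hnorm]
    calc (n : ℝ)⁻¹ * ‖scoreVec x y Q β - scoreVec x y Q β'‖
        ≤ (n : ℝ)⁻¹ * (2 * q * L * m * (n * b₄) * ‖β - β'‖) := by gcongr
      _ = 2 * q * L * m * b₄ * ‖β - β'‖ := by field_simp
      _ ≤ lip * ‖β - β'‖ := by gcongr
  · have key := hnoise.norm_scoreVec_le hG hQ hq
    have hlip0 : 0 < lip := hc.trans_le hclip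
    rw [hnorm]
    have h1 : (n : ℝ)⁻¹ * √(n * p) = √((p : ℝ) / n) := by
      rw [Real.sqrt_mul hn'.le, Real.sqrt_div (Nat.cast_nonneg _)]
      field_simp
      rw [Real.sq_sqrt hn'.le]
    calc c / lip ^ 2 * ((n : ℝ)⁻¹ * ‖scoreVec x y Q β₀‖)
        ≤ c / lip ^ 2 * ((n : ℝ)⁻¹ * (m ^ 2 * q * (G * √(n * p)))) := by gcongr
      _ = c / lip ^ 2 * (m ^ 2 * q * G) * ((n : ℝ)⁻¹ * √(n * p)) := by ring
      _ ≤ (1 - √(1 - c ^ 2 / lip ^ 2)) * M * √((p : ℝ) / n) := by rw [h1]; gcongr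
      _ = _ := by ring

end Zero

section Probability

variable {n m p : ℕ} {Ω : Type*} [MeasurableSpace Ω] {P : Measure Ω}

/-! ### Tail bounds for the noise -/

/-- Markov's inequality in a form that is also valid for `a = 0`. -/
theorem measure_lt_le_of_integral_le [IsFiniteMeasure P] {f : Ω → ℝ} {a ε : ℝ} (hf : Integrable f P)
    (hf0 : ∀ ω, 0 ≤ f ω) (ha : 0 ≤ a) (h : ∫ ω, f ω ∂P ≤ a) (hε : 0 < ε) :
    P {ω | ε⁻¹ * a < f ω} ≤ ENNReal.ofReal ε := by
  rcases ha.eq_or_lt with rfl | ha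
  · have h0 : ∫ ω, f ω ∂P = 0 := le_antisymm h (integral_nonneg hf0)
    have := (integral_eq_zero_iff_of_nonneg hf0 hf).1 h0
    have h1 : P {ω | ε⁻¹ * 0 < f ω} = 0 := by
      rw [← nonpos_iff_eq_zero, ← (ae_iff.1 this)]
      refine measure_mono fun ω hω => ?_
      rw [Set.mem_ofPred_eq, mul_zero] at hω
      exact hω.ne'
    rw [h1]; exact zero_le
  · have h1 := mul_meas_ge_le_integral_of_nonneg (ae_of_all P hf0) hf (ε⁻¹ * a)
    have h2 : P.real {ω | ε⁻¹ * a ≤ f ω} ≤ ε := by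
      have h3 : ε⁻¹ * a * P.real {ω | ε⁻¹ * a ≤ f ω} ≤ ε⁻¹ * a * ε :=
        (h1.trans h).trans_eq (by field_simp)
      exact le_of_mul_le_mul_left h3 (by positivity)
    refine (measure_mono (t := {ω | ε⁻¹ * a ≤ f ω})
      fun ω (hω : ε⁻¹ * a < f ω) => le_of_lt hω).trans ?_
    rw [← ofReal_measureReal]
    exact ENNReal.ofReal_le_ofReal h2

/-- Distinct clusters are independent and binary variables have variance at most one. -/
theorem IsClusteredBinary.integrable_and_integral_sq_le [IsProbabilityMeasure P]
    {x : Fin n → Fin m → EuclideanSpace ℝ (Fin p)} {Y : Fin n → Fin m → Ω → ℝ}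
    {β₀ : EuclideanSpace ℝ (Fin p)} (h : IsClusteredBinary P x Y β₀) (k : Fin m)
    (c : Fin n → ℝ) :
    Integrable (fun ω => (∑ i, c i * (Y i k ω - prob (x i k) β₀)) ^ 2) P ∧
    ∫ ω, (∑ i, c i * (Y i k ω - prob (x i k) β₀)) ^ 2 ∂P ≤ ∑ i, c i ^ 2 := by
  have hY : ∀ i, MemLp (Y i k) 2 P := fun i =>
    MemLp.of_bound (h.measurable i k).aestronglyMeasurable 1 (by
      filter_upwards [h.binary i k] with ω hω
      rcases hω with hω | hω <;> simp [hω])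
  have hZ : ∀ i, MemLp (fun ω => c i * (Y i k ω - prob (x i k) β₀)) 2 P := fun i =>
    ((hY i).sub (memLp_const _)).const_mul _
  -- As the sum is centred, its second moment is its variance, which is additive.
  have hsum : MemLp (∑ i, fun ω => c i * (Y i k ω - prob (x i k) β₀)) 2 P :=
    memLp_finsetSum' _ fun i _ => hZ i
  have hfun : (∑ i, fun ω => c i * (Y i k ω - prob (x i k) β₀)) =
      fun ω => ∑ i, c i * (Y i k ω - prob (x i k) β₀) := by
    ext ω; simp
  have hmean : ∫ ω, (∑ i, fun ω => c i * (Y i k ω - prob (x i k) β₀)) ω ∂P = 0 := by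
    rw [hfun, integral_finsetSum _ fun i _ => (hZ i).integrable (by norm_num)]
    refine Finset.sum_eq_zero fun i _ => ?_
    rw [integral_const_mul, integral_sub ((hY i).integrable (by norm_num)) (integrable_const _),
      h.mean i k]
    simp
  have hind : Set.Pairwise ((Finset.univ : Finset (Fin n)) : Set (Fin n)) fun i i' =>
      IndepFun (fun ω => c i * (Y i k ω - prob (x i k) β₀))
        (fun ω => c i' * (Y i' k ω - prob (x i' k) β₀)) P := by
    intro i _ i' _ hne
    exact (h.indep.indepFun hne).comp (φ := fun v => c i * (v k - prob (x i k) β₀))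
      (ψ := fun v => c i' * (v k - prob (x i' k) β₀)) (by fun_prop) (by fun_prop)
  have hvar := IndepFun.variance_sum (fun i _ => hZ i) hind
  rw [variance_of_integral_eq_zero hsum.aestronglyMeasurable.aemeasurable hmean] at hvar
  refine ⟨by simpa [hfun] using hsum.integrable_sq, ?_⟩
  rw [hfun] at hvar
  refine hvar.trans_le (Finset.sum_le_sum fun i _ => ?_)
  rw [variance_const_mul, variance_sub_const (h.measurable i k).aestronglyMeasurable]
  have hv : variance (Y i k) P ≤ ((1 - 0) / 2) ^ 2 := by
    refine variance_le_sq_of_bounded ?_ (h.measurable i k).aemeasurable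
    filter_upwards [h.binary i k] with ω hω
    rcases hω with hω | hω <;> simp [hω]
  nlinarith [sq_nonneg (c i)]

/-- A tail bound for the sum of independent centred terms `(Yᵢₖ - πᵢₖ) vᵢ`, one for each cluster,
with nonrandom vectors `vᵢ` of squared norm at most `V`. -/
theorem IsClusteredBinary.measure_noise_le [IsProbabilityMeasure P]
    {x : Fin n → Fin m → EuclideanSpace ℝ (Fin p)} {Y : Fin n → Fin m → Ω → ℝ}
    {β₀ : EuclideanSpace ℝ (Fin p)} (h : IsClusteredBinary P x Y β₀) (k : Fin m)
    {ι : Type*} [Fintype ι] (v : Fin n → ι → ℝ) {V ε : ℝ} (hV : 0 ≤ V)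
    (hv : ∀ i, ∑ a, v i a ^ 2 ≤ V) (hε : 0 < ε) :
    P {ω | ε⁻¹ * (n * V) < ∑ a, (∑ i, v i a * (Y i k ω - prob (x i k) β₀)) ^ 2} ≤
      ENNReal.ofReal ε := by
  have hi := fun a => h.integrable_and_integral_sq_le k (fun i => v i a)
  refine measure_lt_le_of_integral_le (integrable_finsetSum _ fun a _ => (hi a).1)
    (fun ω => by positivity) (by positivity) ?_ hε
  rw [integral_finsetSum _ fun a _ => (hi a).1]
  calc _ ≤ ∑ a, ∑ i, v i a ^ 2 := Finset.sum_le_sum fun a _ => (hi a).2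
    _ = ∑ i, ∑ a, v i a ^ 2 := Finset.sum_comm
    _ ≤ ∑ _i : Fin n, V := Finset.sum_le_sum fun i _ => hv i
    _ = n * V := by simp

theorem sum_mul_apply_sq_le {g A V : ℝ} (hg : |g| ≤ A) {ι : Type*} [Fintype ι] {v : ι → ℝ}
    (hv : ∑ a, v a ^ 2 ≤ V) : ∑ a, (g * v a) ^ 2 ≤ A ^ 2 * V := by
  simp only [mul_pow, ← Finset.mul_sum]
  have : g ^ 2 ≤ A ^ 2 := sq_le_sq' (abs_le.1 hg).1 (abs_le.1 hg).2
  exact mul_le_mul this hv (by positivity) (by positivity)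

theorem measure_exists_lt_le {f : Fin m → Fin m → Ω → ℝ} {a ε : ℝ}
    (h : ∀ j k, P {ω | a < f j k ω} ≤ ENNReal.ofReal ε) :
    P {ω | ∃ j k, a < f j k ω} ≤ ENNReal.ofReal (m ^ 2 * ε) := by
  have hU : {ω | ∃ j k, a < f j k ω} = ⋃ j, ⋃ k, {ω | a < f j k ω} := by
    ext ω; simp
  calc P {ω | ∃ j k, a < f j k ω} ≤ ∑ _j : Fin m, ∑ _k : Fin m, ENNReal.ofReal ε := by
        rw [hU]
        refine (measure_iUnion_fintype_le _ _).trans (Finset.sum_le_sum fun j _ => ?_)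
        exact (measure_iUnion_fintype_le _ _).trans (Finset.sum_le_sum fun k _ => h j k)
    _ = ENNReal.ofReal (m ^ 2 * ε) := by
        simp only [Finset.sum_const, Finset.card_univ, Fintype.card_fin, nsmul_eq_mul]
        rw [← ENNReal.ofReal_natCast, ← ENNReal.ofReal_mul (by positivity),
          ← ENNReal.ofReal_mul (by positivity)]
        congr 1
        ring

theorem IsClusteredBinary.measure_not_noiseBound_le [IsProbabilityMeasure P]
    {x : Fin n → Fin m → EuclideanSpace ℝ (Fin p)} {Y : Fin n → Fin m → Ω → ℝ}
    {β₀ : EuclideanSpace ℝ (Fin p)} (h : IsClusteredBinary P x Y β₀) {T A C ε : ℝ}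
    (hA : CoefficientBound T A) (hβ₀ : ∀ i j, |(inner ℝ (x i j) β₀ : ℝ)| ≤ T) (hC : 1 ≤ C)
    (hx : ∀ i j, ‖x i j‖ ≤ C * √p) (hε : 0 < ε) :
    P {ω | ¬ NoiseBound x (fun i j => Y i j ω) β₀ (√ε⁻¹ * (A ^ 2 * C ^ 2))} ≤
      ENNReal.ofReal (3 * m ^ 2 * ε) := by
  have hG : (√ε⁻¹ * (A ^ 2 * C ^ 2)) ^ 2 = ε⁻¹ * (A ^ 4 * C ^ 4) := by
    rw [mul_pow, Real.sq_sqrt (by positivity)]; ring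
  have hxsq : ∀ i j, ∑ a, x i j a ^ 2 ≤ C ^ 2 * p := by
    intro i j
    have h1 : ∑ a, x i j a ^ 2 = ‖x i j‖ ^ 2 := by simp [EuclideanSpace.norm_sq_eq]
    rw [h1, ← Real.sq_sqrt (Nat.cast_nonneg p), ← mul_pow]
    exact pow_le_pow_left₀ (norm_nonneg _) (hx i j) 2
  have hxsq2 : ∀ i j, ∑ a, x i j a ^ 2 ≤ C ^ 4 * p := fun i j =>
    (hxsq i j).trans (by gcongr; norm_num)
  have hxx : ∀ i j k, ∑ c : Fin p × Fin p, (x i j c.1 * x i k c.2) ^ 2 ≤ C ^ 4 * p ^ 2 := by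
    intro i j k
    simp only [mul_pow, Fintype.sum_prod_type, ← Finset.sum_mul_sum]
    refine (mul_le_mul (hxsq i j) (hxsq i k) (by positivity) (by positivity)).trans_eq ?_
    ring
  have hcoef : ∀ {a b : ℝ}, |a| ≤ A → |b| ≤ A → |a * b| ≤ A ^ 2 := by
    intro a b ha hb
    rw [abs_mul, sq]
    exact mul_le_mul ha hb (abs_nonneg _) ((abs_nonneg _).trans ha)
  have e₁ := measure_exists_lt_le fun j k => h.measure_noise_le k (fun i a =>
    stdDev (inner ℝ (x i j) β₀) * (stdDev (inner ℝ (x i k) β₀))⁻¹ * x i j a) (V := A ^ 4 * C ^ 4 * p)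
    (by positivity)
    (fun i => (sum_mul_apply_sq_le (hcoef (hA.stdDev_le _ (hβ₀ i j))
      (hA.inv_stdDev_le _ (hβ₀ i k))) (hxsq2 i j)).trans_eq (by ring)) hε
  have e₂ := measure_exists_lt_le fun j k => h.measure_noise_le k (fun i (c : Fin p × Fin p) =>
    stdDevDeriv (inner ℝ (x i j) β₀) *
    (stdDev (inner ℝ (x i k) β₀))⁻¹ * (x i j c.1 * x i j c.2)) (V := A ^ 4 * C ^ 4 * p ^ 2)
    (by positivity)
    (fun i => (sum_mul_apply_sq_le (hcoef (hA.stdDevDeriv_le _ (hβ₀ i j))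
      (hA.inv_stdDev_le _ (hβ₀ i k))) (hxx i j j)).trans_eq (by ring)) hε
  have e₃ := measure_exists_lt_le fun j k => h.measure_noise_le k (fun i (c : Fin p × Fin p) =>
    stdDev (inner ℝ (x i j) β₀) *
    Real.sinh (inner ℝ (x i k) β₀ / 2) * (x i j c.1 * x i k c.2)) (V := A ^ 4 * C ^ 4 * p ^ 2)
    (by positivity)
    (fun i => (sum_mul_apply_sq_le (hcoef (hA.stdDev_le _ (hβ₀ i j))
      (hA.sinh_le _ (hβ₀ i k))) (hxx i j k)).trans_eq (by ring)) hε
  have hunion := (measure_union_le _ _).trans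
    (add_le_add e₁ ((measure_union_le _ _).trans (add_le_add e₂ e₃)))
  refine (measure_mono fun ω hω => ?_).trans (hunion.trans_eq ?_)
  · by_contra hcon
    simp only [Set.mem_union, Set.mem_ofPred_eq, not_or, not_exists, not_lt] at hcon
    refine hω ⟨fun j k => ?_, fun j k => ?_, fun j k => ?_⟩
    · rw [hG]
      exact (hcon.1 j k).trans_eq (by ring)
    · rw [hG]
      exact (hcon.2.1 j k).trans_eq (by ring)
    · rw [hG]
      exact (hcon.2.2 j k).trans_eq (by ring)
  · rw [← ENNReal.ofReal_add (by positivity) (by positivity),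
      ← ENNReal.ofReal_add (by positivity) (by positivity)]
    congr 1
    ring

/-! ### Measurability of the estimator -/

theorem measurable_matrix_inv {R : Ω → Matrix (Fin m) (Fin m) ℝ}
    (hR : ∀ j k, Measurable fun ω => R ω j k) (j k : Fin m) :
    Measurable fun ω => (R ω)⁻¹ j k := by
  have hR' : Measurable fun ω => (fun j k => R ω j k : Fin m → Fin m → ℝ) :=
    measurable_pi_lambda _ fun j => measurable_pi_lambda _ fun k => hR j k
  have hcdet : Continuous fun f : Fin m → Fin m → ℝ => (Matrix.of f).det :=
    Continuous.matrix_det (A := fun f : Fin m → Fin m → ℝ => Matrix.of f) continuous_id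
  have hcadj : Continuous fun f : Fin m → Fin m → ℝ => (Matrix.of f).adjugate j k :=
    (Continuous.matrix_adjugate (A := fun f : Fin m → Fin m → ℝ => Matrix.of f)
      continuous_id).matrix_elem j k
  have hdet : Measurable fun ω => (R ω).det := hcdet.measurable.comp hR'
  have hadj : Measurable fun ω => (R ω).adjugate j k := hcadj.measurable.comp hR'
  have : (fun ω => (R ω)⁻¹ j k) = fun ω => ((R ω).det)⁻¹ * (R ω).adjugate j k := by
    ext ω
    rw [Matrix.inv_def, Matrix.smul_apply, Ring.inverse_eq_inv', smul_eq_mul]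
  rw [this]
  exact hdet.inv.mul hadj

theorem measurable_scoreVec (x : Fin n → Fin m → EuclideanSpace ℝ (Fin p))
    {Y : Fin n → Fin m → Ω → ℝ} (hY : ∀ i j, Measurable (Y i j))
    {Q : Ω → Matrix (Fin m) (Fin m) ℝ} (hQ : ∀ j k, Measurable fun ω => Q ω j k)
    {b : Ω → EuclideanSpace ℝ (Fin p)} (hb : Measurable b) :
    Measurable fun ω => scoreVec x (fun i j => Y i j ω) (Q ω) (b ω) := by
  unfold scoreVec stdDev pearson
  refine Finset.measurable_sum _ fun i _ => Finset.measurable_sum _ fun j _ =>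
    Finset.measurable_sum _ fun k _ => Measurable.smul_const ?_ _
  have h1 := hQ j k
  have h2 := hY i k
  have h3 : ∀ j, Measurable fun ω => (inner ℝ (x i j) (b ω) : ℝ) := fun j => hb.const_inner
  have h4 := h3 j
  have h5 := h3 k
  fun_prop

/-- The `k`-th iterate from `β₀` of the map `β ↦ β + τ S(β) / n`. -/
noncomputable def dampedIterate (x : Fin n → Fin m → EuclideanSpace ℝ (Fin p))
    (y : Fin n → Fin m → ℝ) (Q : Matrix (Fin m) (Fin m) ℝ) (β₀ : EuclideanSpace ℝ (Fin p))
    (τ : ℝ) (k : ℕ) : EuclideanSpace ℝ (Fin p) :=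
  (fun β => β + τ • ((n : ℝ)⁻¹ • scoreVec x y Q β))^[k] β₀

theorem measurable_limUnder_dampedIterate (x : Fin n → Fin m → EuclideanSpace ℝ (Fin p))
    {Y : Fin n → Fin m → Ω → ℝ} (hY : ∀ i j, Measurable (Y i j))
    {R : Ω → Matrix (Fin m) (Fin m) ℝ} (hR : ∀ j k, Measurable fun ω => R ω j k)
    (β₀ : EuclideanSpace ℝ (Fin p)) (τ : ℝ) :
    Measurable fun ω => limUnder atTop (dampedIterate x (fun i j => Y i j ω) (R ω)⁻¹ β₀ τ) := by
  have key : ∀ k, Measurable fun ω =>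
      dampedIterate x (fun i j => Y i j ω) (R ω)⁻¹ β₀ τ k := by
    intro k
    induction k with
    | zero => exact measurable_const
    | succ k ih =>
      simp only [dampedIterate, Function.iterate_succ_apply'] at ih ⊢
      have h := measurable_scoreVec x hY (measurable_matrix_inv hR) ih
      exact ih.add ((h.const_smul (n : ℝ)⁻¹).const_smul τ)
  exact (StronglyMeasurable.limUnder fun k => (key k).stronglyMeasurable).measurable

end Probability

/-! ### Consistency -/

theorem ParameterCondition.exists_abs_inner_le {m : ℕ} {p : ℕ → ℕ}
    {x : ∀ n, Fin n → Fin m → EuclideanSpace ℝ (Fin (p n))}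
    {B : ∀ n, Set (EuclideanSpace ℝ (Fin (p n)))} {β₀ : ∀ n, EuclideanSpace ℝ (Fin (p n))}
    (h : ParameterCondition x B β₀) :
    ∃ T, ∀ᶠ n in atTop, ∀ i j, |(inner ℝ (x n i j) (β₀ n) : ℝ)| ≤ T := by
  obtain ⟨-, b₁, b₂, hb₁, hb₂, hb⟩ := h
  refine ⟨_, hb.mono fun n hn i j => abs_le_of_logistic_mem hb₁ hb₂ (hn i j).1 (hn i j).2⟩

theorem CovariateBound.exists_one_le {m : ℕ} {p : ℕ → ℕ}
    {x : ∀ n, Fin n → Fin m → EuclideanSpace ℝ (Fin (p n))} (h : CovariateBound x) :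
    ∃ C, 1 ≤ C ∧ ∀ᶠ n in atTop, ∀ i j, ‖x n i j‖ ≤ C * √(p n) := by
  obtain ⟨C, hC⟩ := h
  refine ⟨max 1 C, le_max_left _ _, hC.mono fun n hn i j => (hn i j).trans ?_⟩
  exact mul_le_mul_of_nonneg_right (le_max_right _ _) (Real.sqrt_nonneg _)

theorem tendsto_div_sqrt {p : ℕ → ℕ}
    (hp : Tendsto (fun n : ℕ => (p n : ℝ) ^ 2 / n) atTop (𝓝 0)) :
    Tendsto (fun n : ℕ => (p n : ℝ) / √n) atTop (𝓝 0) := by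
  have := (Real.continuous_sqrt.tendsto 0).comp hp
  rw [Real.sqrt_zero] at this
  refine this.congr fun n => ?_
  rw [Function.comp_apply, Real.sqrt_div (by positivity), Real.sqrt_sq (by positivity)]

theorem sqrt_div_le_div_sqrt (p n : ℕ) : √((p : ℝ) / n) ≤ p / √n := by
  rw [Real.sqrt_div (Nat.cast_nonneg _)]
  refine div_le_div_of_nonneg_right ?_ (Real.sqrt_nonneg _)
  refine Real.sqrt_le_iff.2 ⟨Nat.cast_nonneg _, ?_⟩
  exact_mod_cast Nat.le_self_pow two_ne_zero p

/-- With probability at least `1 - ε` for large `n`, the working correlation matrix is invertible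
and the damped iteration converges to a zero of the estimating function within `M √(p / n)` of
`β₀`. The step size `τ` is chosen before `ε`; only the radius factor `M` depends on `ε`. -/
theorem exists_tail_bound {m : ℕ} {p : ℕ → ℕ}
    {Ω : ℕ → Type*} [∀ n, MeasurableSpace (Ω n)]
    {P : ∀ n, Measure (Ω n)} [∀ n, IsProbabilityMeasure (P n)]
    {x : ∀ n, Fin n → Fin m → EuclideanSpace ℝ (Fin (p n))}
    {Y : ∀ n, Fin n → Fin m → Ω n → ℝ}
    {β₀ : ∀ n, EuclideanSpace ℝ (Fin (p n))}
    {B : ∀ n, Set (EuclideanSpace ℝ (Fin (p n)))}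
    {R₀ Rbar : ℕ → Matrix (Fin m) (Fin m) ℝ}
    {Rhat : ∀ n, Ω n → Matrix (Fin m) (Fin m) ℝ}
    (hmodel : ∀ n, IsClusteredBinary (P n) (x n) (Y n) (β₀ n))
    (hx : CovariateBound x) (hβ : ParameterCondition x B β₀) (hgram : GramCondition x)
    (hR : CorrelationCondition p P Y R₀ Rbar Rhat)
    (hp : Tendsto (fun n : ℕ => (p n : ℝ) ^ 2 / n) atTop (𝓝 0)) :
    ∃ τ : ℝ, ∀ ε, 0 < ε → ∃ M, ∀ᶠ n in atTop,
      P n {ω | ¬ (IsUnit (Rhat n ω) ∧ ∃ z, ‖z - β₀ n‖ ≤ M * √((p n : ℝ) / n) ∧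
        score (x n) (fun i j => Y n i j ω) (Rhat n ω) z = 0 ∧
        Tendsto (dampedIterate (x n) (fun i j => Y n i j ω) (Rhat n ω)⁻¹ (β₀ n) τ) atTop (𝓝 z))}
        ≤ ENNReal.ofReal ε := by
  obtain ⟨C, hC, hxC⟩ := hx.exists_one_le
  obtain ⟨T, hT⟩ := hβ.exists_abs_inner_le
  obtain ⟨b₃, b₄, hb₃, hb₄, hb⟩ := hgram
  obtain ⟨-, -, hRbar, ⟨c₁, c₂, hc₁, hc⟩, hOp⟩ := hR
  obtain ⟨L, hL, hTL⟩ := exists_summandBound (T + 1)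
  obtain ⟨A, hA, hTA⟩ := exists_coefficientBound T
  -- The bound `c₂` need not be positive when `m = 0`, hence the maximum with `1`. For the
  -- inverse of `Rhat`, half of the lower bound for that of `Rbar` remains, and its entries exceed
  -- the bound for those of `Rbar` by at most `1`.
  set κ : ℝ := (max c₂ 1)⁻¹ / 2 with hκ
  set q : ℝ := c₁⁻¹ + 1 with hq
  have hc₂ : 0 < max c₂ 1 := lt_max_of_lt_right one_pos
  have hκ0 : 0 < κ := by positivity
  have hq0 : 0 < q := by positivity
  -- Half of the lower bound for the leading term; the other half absorbs noise and remainder.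
  set c : ℝ := κ * A⁻¹ ^ 2 * b₃ / 2 with hcdef
  set lip : ℝ := max c (2 * q * L * m * b₄) with hlip
  have hc0 : 0 < c := by positivity
  have hclip : c ≤ lip := le_max_left _ _
  have hlip0 : 0 < lip := hc0.trans_le hclip
  have hk : 0 < 1 - √(1 - c ^ 2 / lip ^ 2) := by
    rw [sub_pos, Real.sqrt_lt' one_pos]
    have : 0 < c ^ 2 / lip ^ 2 := by positivity
    linarith
  have hsmall : ∀ D δ : ℝ, 0 < δ → ∀ᶠ n in atTop, D * ((p n : ℝ) / √n) ≤ δ := by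
    intro D δ hδ
    have h := (tendsto_div_sqrt hp).const_mul D
    rw [mul_zero] at h
    exact h.eventually_le_const hδ
  refine ⟨c / lip ^ 2, fun ε hε => ?_⟩
  -- There are `3 m²` noise events and one for the estimated working correlation matrix.
  set ε₁ : ℝ := ε / (3 * m ^ 2 + 1) with hε₁
  have hε₁0 : 0 < ε₁ := by positivity
  obtain ⟨K, hK⟩ := hOp ε₁ hε₁0
  set G : ℝ := √ε₁⁻¹ * (A ^ 2 * C ^ 2) with hG
  have hG0 : 0 ≤ G := by positivity
  set M : ℝ := c / lip ^ 2 * (m ^ 2 * q * G) / (1 - √(1 - c ^ 2 / lip ^ 2)) with hM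
  have hM0 : 0 ≤ M := by positivity
  refine ⟨M, ?_⟩
  filter_upwards [hxC, hT, hb, hc, hK, eventually_gt_atTop 0, hsmall (C * M) 1 one_pos,
    hsmall |K| (min κ 1) (by positivity),
    hsmall (2 * m ^ 2 * q * G + 2 * q * L * C * M * m * b₄) c hc0]
    with n hxn hTn hbn hcn hKn hn hs₁ hs₂ hs₃
  have hnoise := (hmodel n).measure_not_noiseBound_le hTA hTn hC hxn hε₁0
  -- The binary values are attained only almost surely.
  have hbin : P n {ω | ¬ ∀ i j, Y n i j ω = 0 ∨ Y n i j ω = 1} = 0 := by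
    rw [← ae_iff, ae_all_iff]
    intro i
    rw [ae_all_iff]
    exact (hmodel n).binary i
  have hunion := (measure_union_le _ _).trans
    (add_le_add hKn ((measure_union_le _ _).trans (add_le_add hnoise hbin.le)))
  refine (measure_mono fun ω hω => ?_).trans (hunion.trans_eq ?_)
  swap
  · rw [add_zero, ← ENNReal.ofReal_add hε₁0.le (by positivity)]
    congr 1
    rw [hε₁]
    field_simp
    ring
  by_contra hcon
  simp only [Set.mem_union, Set.mem_ofPred_eq, not_or, not_not, not_lt] at hcon
  obtain ⟨hfrob, hNB, hy⟩ := hcon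
  have hfrob' : frobNorm ((Rhat n ω)⁻¹ - (Rbar n)⁻¹) ≤ min κ 1 := by
    refine ((le_abs_self _).trans hfrob).trans (le_trans ?_ hs₂)
    refine mul_le_mul (le_abs_self K) (sqrt_div_le_div_sqrt _ _) (Real.sqrt_nonneg _)
      (abs_nonneg _)
  have hcn' : EigenvaluesIn (Rbar n) c₁ (max c₂ 1) := fun μ hμ =>
    ⟨(hcn μ hμ).1, (hcn μ hμ).2.trans (le_max_left _ _)⟩
  obtain ⟨hpos, hentry⟩ := hcn'.inv_bounds (hRbar n) hc₁ hc₂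
  have hQpos : ∀ z : Fin m → ℝ,
      κ * ∑ j, z j ^ 2 ≤ ∑ j, ∑ k, (Rhat n ω)⁻¹ j k * (z j * z k) := by
    have := le_quadForm_of_frobNorm_sub_le hpos (hfrob'.trans (min_le_left _ _))
    rwa [show (max c₂ 1)⁻¹ - κ = κ by rw [hκ]; ring] at this
  have hQ : ∀ j k, |(Rhat n ω)⁻¹ j k| ≤ q := by
    intro j k
    have h1 := (abs_apply_le_frobNorm _ j k).trans (hfrob'.trans (min_le_right _ _))
    rw [Matrix.sub_apply] at h1
    have h2 := abs_add_le ((Rhat n ω)⁻¹ j k - (Rbar n)⁻¹ j k) ((Rbar n)⁻¹ j k)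
    rw [sub_add_cancel] at h2
    have := hentry j k
    rw [hq]; linarith
  have hgr := fun u => hbn.sum_inner_sq_bounds hn u
  obtain ⟨z, hz, hz0, hlim⟩ := exists_zero_scoreVec hn (by linarith) hL hb₄.le hκ0.le hq0.le
    (inv_nonneg.2 hA.le) hG0 hM0 hxn hTn (fun u => (hgr u).1) (fun u => (hgr u).2) hQ hQpos hy hTL
    (fun i j => by
      have h1 := hTA.inv_stdDev_le _ (hTn i j)
      rw [abs_of_pos (inv_pos.2 (stdDev_pos _))] at h1
      exact inv_le_of_inv_le₀ (stdDev_pos _) h1)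
    hNB hs₁ hc0
    (by
      have h1 : κ * A⁻¹ ^ 2 * b₃ = 2 * c := by rw [hcdef]; ring
      rw [h1]
      linarith)
    hclip (le_max_right _ _)
    (by rw [hM, mul_div_cancel₀ _ hk.ne'])
  refine hω ⟨isUnit_of_le_quadForm_inv hκ0 hQpos, z, mem_closedBall_iff_norm.1 hz, ?_, hlim⟩
  rw [score_eq, hz0]
  rfl

end GEE

theorem theorem3p6 (m : ℕ) (p : ℕ → ℕ)
    {Ω : ℕ → Type*} [∀ n, MeasurableSpace (Ω n)]
    (P : ∀ n, Measure (Ω n)) [∀ n, IsProbabilityMeasure (P n)]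
    (x : ∀ n, Fin n → Fin m → EuclideanSpace ℝ (Fin (p n)))
    (Y : ∀ n, Fin n → Fin m → Ω n → ℝ)
    (β₀ : ∀ n, EuclideanSpace ℝ (Fin (p n)))
    (B : ∀ n, Set (EuclideanSpace ℝ (Fin (p n))))
    (R₀ Rbar : ℕ → Matrix (Fin m) (Fin m) ℝ)
    (Rhat : ∀ n, Ω n → Matrix (Fin m) (Fin m) ℝ)
    (hRhat : ∀ n j k, Measurable fun ω => Rhat n ω j k)
    (hmodel : ∀ n, GEE.IsClusteredBinary (P n) (x n) (Y n) (β₀ n))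
    (hx : GEE.CovariateBound x)
    (hβ : GEE.ParameterCondition x B β₀)
    (hgram : GEE.GramCondition x)
    (hR : GEE.CorrelationCondition p P Y R₀ Rbar Rhat)
    (hp : Tendsto (fun n : ℕ => (p n : ℝ) ^ 2 / n) atTop (𝓝 0)) :
    ∃ βhat : ∀ n, Ω n → EuclideanSpace ℝ (Fin (p n)),
      (∀ n, Measurable (βhat n)) ∧
      Tendsto (fun n => P n {ω | IsUnit (Rhat n ω) ∧
        GEE.score (x n) (fun i j => Y n i j ω) (Rhat n ω) (βhat n ω) = 0}) atTop (𝓝 1) ∧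
      GEE.IsBigOP P (fun n ω => ‖βhat n ω - β₀ n‖) (fun n => √((p n : ℝ) / n)) := by
  obtain ⟨τ, hτ⟩ := GEE.exists_tail_bound hmodel hx hβ hgram hR hp
  refine ⟨fun n ω => limUnder atTop
    (GEE.dampedIterate (x n) (fun i j => Y n i j ω) (Rhat n ω)⁻¹ (β₀ n) τ),
    fun n => GEE.measurable_limUnder_dampedIterate (x n) (hmodel n).measurable (hRhat n) (β₀ n) τ,
    ?_, ?_⟩
  · refine tendsto_order.2 ⟨fun a ha => ?_, fun a ha => Eventually.of_forall fun n =>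
      prob_le_one.trans_lt ha⟩
    obtain ⟨ε, hε, haε⟩ : ∃ ε : ℝ, 0 < ε ∧ a + ENNReal.ofReal ε < 1 := by
      obtain ⟨δ, hδ0, hδ⟩ := ENNReal.lt_iff_exists_add_pos_lt.1 ha
      exact ⟨δ, hδ0, by simpa using hδ⟩
    obtain ⟨M, hM⟩ := hτ ε hε
    filter_upwards [hM] with n hn
    by_contra hcon
    refine absurd haε (not_lt.2 ?_)
    rw [← measure_univ (μ := P n)]
    refine le_trans ?_ (add_le_add (not_lt.1 hcon) hn)
    refine (measure_mono fun ω _ => ?_).trans (measure_union_le _ _)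
    by_cases hω : IsUnit (Rhat n ω) ∧ ∃ z, ‖z - β₀ n‖ ≤ M * √((p n : ℝ) / n) ∧
        GEE.score (x n) (fun i j => Y n i j ω) (Rhat n ω) z = 0 ∧
        Tendsto (GEE.dampedIterate (x n) (fun i j => Y n i j ω) (Rhat n ω)⁻¹ (β₀ n) τ) atTop (𝓝 z)
    · obtain ⟨hunit, z, -, hz, hlim⟩ := hω
      exact Or.inl ⟨hunit, by rw [hlim.limUnder_eq]; exact hz⟩
    · exact Or.inr hω
  · intro ε hε
    obtain ⟨M, hM⟩ := hτ ε hε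
    refine ⟨M, hM.mono fun n hn => (measure_mono fun ω hω => ?_).trans hn⟩
    rintro ⟨-, z, hz, -, hlim⟩
    have hω' : M * √((p n : ℝ) / n) < |‖limUnder atTop
      (GEE.dampedIterate (x n) (fun i j => Y n i j ω) (Rhat n ω)⁻¹ (β₀ n) τ) - β₀ n‖| := hω
    rw [hlim.limUnder_eq, abs_norm] at hω'
    exact absurd hz (not_le.2 hω')
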